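/- Let $G$ be a finite group. An automorphism $\tau$ of $G$ is called *involutory* if $\tau(\tau(g))=g$ for all $g\in G$ (so the identity is allowed), and *class-inverting* if $\chi(\tau(g))=\overline{\chi(g)}=\chi(g^{-1})$ for all $g \in G$ and all characters $\chi$ of finite-dimensional complex representations of $G$. The group $G$ is called *quasi-ambivalent* if it admits an involutory class-inverting automorphism, and *ambivalent* if it admits an involutory class-inverting inner automorphism (possibly the identity). Let $\omega=e^{2\pi i/3}$, $\varepsilon=e^{4\pi i/9}$, $\mu_1=\tfrac{-1+\sqrt5}{2}$, $\mu_2=\tfrac{-1-\sqrt5}{2}$, and consider the following elements of $\mathrm{SU}(3)$: $$C=\begin{pmatrix}1&0&0\\0&\omega&0\\0&0&\omega^2\end{pmatrix},\quad E=\begin{pmatrix}0&1&0\\0&0&1\\1&0&0\end{pmatrix},\quad V=\frac{1}{i\sqrt3}\begin{pmatrix}1&1&1\\1&\omega&\omega^2\\1&\omega^2&\omega\end{pmatrix},\quad X=\frac{1}{i\sqrt3}\begin{pmatrix}1&1&\omega^2\\1&\omega&\omega\\\omega&1&\omega\end{pmatrix},$$ $$D=\begin{pmatrix}\varepsilon&0&0\\0&\varepsilon&0\\0&0&\varepsilon\omega\end{pmatrix},\quad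 B=\begin{pmatrix}1&0&0\\0&-1&0\\0&0&-1\end{pmatrix},\quad W=\frac12\begin{pmatrix}-1&\mu_2&\mu_1\\\mu_2&\mu_1&-1\\\mu_1&-1&\mu_2\end{pmatrix},\quad Q=\begin{pmatrix}-1&0&0\\0&0&-\omega\\0&-\omega^2&0\end{pmatrix}.$$ The crystal-like subgroups of $\mathrm{SU}(3)$, of orders $108$, $216$, $648$ and $1080$ respectively, are $$\Sigma(108)=\langle C,E,V\rangle,\quad \Sigma(216)=\langle C,E,V,X\rangle,\quad \Sigma(648)=\langle C,E,V,D\rangle,\quad \Sigma(1080)=\langle B,E,W,Q\rangle .$$ **Proposition.** The groups $\Sigma(108)$ and $\Sigma(648)$ are quasi-ambivalent but not ambivalent. The groups $\Sigma(216)$ and $\Sigma(1080)$ are not quasi-ambivalent. -/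

import Mathlib

open Complex Matrix

/-! ## Class-inverting automorphisms, ambivalence, quasi-ambivalence -/

/-- An automorphism `τ` of a (finite) group is class-inverting if `χ (τ g) = χ (g⁻¹)` for every
`g` and for the character `χ` of every finite-dimensional complex representation. (For a finite
group `χ (g⁻¹)` is the complex conjugate of `χ g`.) -/
def IsClassInverting {G : Type} [Group G] (τ : MulAut G) : Prop :=
  ∀ (V : Type) [AddCommGroup V] [Module ℂ V] [FiniteDimensional ℂ V]
    (ρ : Representation ℂ G V) (g : G), ρ.character (τ g) = ρ.character g⁻¹

/-- `τ` is involutory if `τ (τ g) = g` for all `g` (the identity is allowed). -/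
def IsInvolutory {G : Type} [Group G] (τ : MulAut G) : Prop :=
  ∀ g : G, τ (τ g) = g

/-- A group is quasi-ambivalent if it has an involutory class-inverting automorphism. -/
def IsQuasiAmbivalent (G : Type) [Group G] : Prop :=
  ∃ τ : MulAut G, IsInvolutory τ ∧ IsClassInverting τ

/-- A group is ambivalent if it has an involutory class-inverting inner automorphism
(the identity is allowed). -/
def IsAmbivalent (G : Type) [Group G] : Prop :=
  ∃ τ : MulAut G, (∃ h : G, τ = MulAut.conj h) ∧ IsInvolutory τ ∧ IsClassInverting τ

/-! ## The crystal-like subgroups of `SU(3)` -/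

namespace CrystalLike

/-- The primitive cube root of unity `exp (2πi/3)`. -/
noncomputable def ω : ℂ := exp (2 * Real.pi * I / 3)

/-- `exp (4πi/9)`. -/
noncomputable def ε : ℂ := exp (4 * Real.pi * I / 9)

/-- `1 / (i√3)`. -/
noncomputable def κ : ℂ := 1 / (I * ((√3 : ℝ) : ℂ))

/-- `(-1 + √5) / 2`. -/
noncomputable def μ₁ : ℂ := (-1 + ((√5 : ℝ) : ℂ)) / 2

/-- `(-1 - √5) / 2`. -/
noncomputable def μ₂ : ℂ := (-1 - ((√5 : ℝ) : ℂ)) / 2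

theorem omega_eq : ω = -1 / 2 + ((√3 : ℝ) : ℂ) / 2 * I := by
  have h : ω = exp (((2 * Real.pi / 3 : ℝ) : ℂ) * I) := by
    unfold ω; congr 1; push_cast; ring
  have e : (2 * Real.pi / 3 : ℝ) = Real.pi - Real.pi / 3 := by ring
  rw [h, exp_mul_I, ← ofReal_cos, ← ofReal_sin, e, Real.cos_pi_sub, Real.sin_pi_sub,
    Real.cos_pi_div_three, Real.sin_pi_div_three]
  push_cast; ring

theorem sqrt_three_sq : ((√3 : ℝ) : ℂ) ^ 2 = 3 := by
  rw [← ofReal_pow, Real.sq_sqrt (by norm_num)]; norm_num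

theorem sqrt_five_sq : ((√5 : ℝ) : ℂ) ^ 2 = 5 := by
  rw [← ofReal_pow, Real.sq_sqrt (by norm_num)]; norm_num

theorem omega_sum : 1 + ω + ω ^ 2 = 0 := by
  rw [omega_eq]
  linear_combination (1 / 4 * I ^ 2) * sqrt_three_sq + 3 / 4 * I_sq

theorem star_omega : (starRingEnd ℂ) ω = ω ^ 2 := by
  have h : (starRingEnd ℂ) ω = -1 / 2 - ((√3 : ℝ) : ℂ) / 2 * I := by
    rw [omega_eq]; simp [sub_eq_add_neg, map_ofNat]
  have h2 := omega_sum
  rw [h]; rw [omega_eq] at h2 ⊢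
  linear_combination -h2

theorem kappa_sq : κ ^ 2 = -1 / 3 := by
  unfold κ
  rw [div_pow, mul_pow, I_sq, sqrt_three_sq]; norm_num

theorem star_kappa : (starRingEnd ℂ) κ = -κ := by
  simp [κ]

theorem kappa_omega : κ * (ω - ω ^ 2) = 1 := by
  have h3 : ((√3 : ℝ) : ℂ) ≠ 0 := by
    intro h; have := sqrt_three_sq; rw [h] at this; norm_num at this
  have h : ω - ω ^ 2 = I * ((√3 : ℝ) : ℂ) := by
    have h2 := omega_sum
    rw [omega_eq] at h2 ⊢
    linear_combination -h2
  rw [h]; unfold κ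
  exact one_div_mul_cancel (mul_ne_zero I_ne_zero h3)

theorem star_epsilon_mul : (starRingEnd ℂ) ε * ε = 1 := by
  unfold ε
  rw [← exp_conj, ← exp_add]
  simp [map_ofNat]
  ring_nf; simp

theorem epsilon_cube : ε ^ 3 = ω ^ 2 := by
  unfold ε ω
  rw [← exp_nat_mul, ← exp_nat_mul]; congr 1; push_cast; ring

theorem star_mu₁ : (starRingEnd ℂ) μ₁ = μ₁ := by simp [μ₁, map_ofNat]

theorem star_mu₂ : (starRingEnd ℂ) μ₂ = μ₂ := by simp [μ₂, map_ofNat]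

theorem mu_add : μ₁ + μ₂ = -1 := by unfold μ₁ μ₂; ring

theorem mu_mul : μ₁ * μ₂ = -1 := by
  unfold μ₁ μ₂; linear_combination (-1 / 4) * sqrt_five_sq

/-- `diag(1, ω, ω²)`. -/
noncomputable def matC : Matrix (Fin 3) (Fin 3) ℂ :=
  !![1, 0, 0; 0, ω, 0; 0, 0, ω ^ 2]

/-- The cyclic permutation matrix. -/
noncomputable def matE : Matrix (Fin 3) (Fin 3) ℂ :=
  !![0, 1, 0; 0, 0, 1; 1, 0, 0]

/-- The Fourier matrix. -/
noncomputable def matV : Matrix (Fin 3) (Fin 3) ℂ :=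
  κ • !![1, 1, 1; 1, ω, ω ^ 2; 1, ω ^ 2, ω]

noncomputable def matX : Matrix (Fin 3) (Fin 3) ℂ :=
  κ • !![1, 1, ω ^ 2; 1, ω, ω; ω, 1, ω]

/-- `diag(ε, ε, εω)`. -/
noncomputable def matD : Matrix (Fin 3) (Fin 3) ℂ :=
  !![ε, 0, 0; 0, ε, 0; 0, 0, ε * ω]

/-- `diag(1, -1, -1)`. -/
noncomputable def matB : Matrix (Fin 3) (Fin 3) ℂ :=
  !![1, 0, 0; 0, -1, 0; 0, 0, -1]

noncomputable def matW : Matrix (Fin 3) (Fin 3) ℂ :=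
  (1 / 2 : ℂ) • !![-1, μ₂, μ₁; μ₂, μ₁, -1; μ₁, -1, μ₂]

noncomputable def matQ : Matrix (Fin 3) (Fin 3) ℂ :=
  !![-1, 0, 0; 0, 0, -ω; 0, -ω ^ 2, 0]

theorem omega_cube : ω ^ 3 = 1 := by
  linear_combination (ω - 1) * omega_sum

theorem matC_mem : matC ∈ specialUnitaryGroup (Fin 3) ℂ := by
  rw [mem_specialUnitaryGroup_iff, mem_unitaryGroup_iff]
  have h1 := omega_cube
  constructor
  · ext i j
    fin_cases i <;> fin_cases j <;>
      simp [matC, Matrix.mul_apply, Fin.sum_univ_three, star_omega] <;> grind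
  · simp [matC, Matrix.det_fin_three]; grind

theorem matE_mem : matE ∈ specialUnitaryGroup (Fin 3) ℂ := by
  rw [mem_specialUnitaryGroup_iff, mem_unitaryGroup_iff]
  constructor
  · ext i j
    fin_cases i <;> fin_cases j <;> simp [matE, Matrix.mul_apply, Fin.sum_univ_three]
  · simp [matE, Matrix.det_fin_three]

theorem matV_mem : matV ∈ specialUnitaryGroup (Fin 3) ℂ := by
  rw [mem_specialUnitaryGroup_iff, mem_unitaryGroup_iff]
  have h1 := omega_sum
  have h2 := kappa_sq
  have h3 := kappa_omega
  constructor
  · ext i j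
    fin_cases i <;> fin_cases j <;>
      simp [matV, Matrix.mul_apply, Fin.sum_univ_three, star_omega, star_kappa] <;> grind
  · simp [matV, Matrix.det_fin_three]; grind

theorem matX_mem : matX ∈ specialUnitaryGroup (Fin 3) ℂ := by
  rw [mem_specialUnitaryGroup_iff, mem_unitaryGroup_iff]
  have h1 := omega_sum
  have h2 := kappa_sq
  have h3 := kappa_omega
  constructor
  · ext i j
    fin_cases i <;> fin_cases j <;>
      simp [matX, Matrix.mul_apply, Fin.sum_univ_three, star_omega, star_kappa] <;> grind
  · simp [matX, Matrix.det_fin_three]; grind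

theorem matD_mem : matD ∈ specialUnitaryGroup (Fin 3) ℂ := by
  rw [mem_specialUnitaryGroup_iff, mem_unitaryGroup_iff]
  have h1 := omega_cube
  have h2 := star_epsilon_mul
  have h3 := epsilon_cube
  constructor
  · ext i j
    fin_cases i <;> fin_cases j <;>
      simp [matD, Matrix.mul_apply, Fin.sum_univ_three, star_omega] <;> grind
  · simp [matD, Matrix.det_fin_three]; grind

theorem matB_mem : matB ∈ specialUnitaryGroup (Fin 3) ℂ := by
  rw [mem_specialUnitaryGroup_iff, mem_unitaryGroup_iff]
  constructor
  · ext i j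
    fin_cases i <;> fin_cases j <;> simp [matB, Matrix.mul_apply, Fin.sum_univ_three]
  · simp [matB, Matrix.det_fin_three]

theorem matW_mem : matW ∈ specialUnitaryGroup (Fin 3) ℂ := by
  rw [mem_specialUnitaryGroup_iff, mem_unitaryGroup_iff]
  have h1 := mu_add
  have h2 := mu_mul
  constructor
  · ext i j
    fin_cases i <;> fin_cases j <;>
      simp [matW, Matrix.mul_apply, Fin.sum_univ_three, star_mu₁, star_mu₂, map_ofNat] <;> grind
  · simp [matW, Matrix.det_fin_three]; grind

theorem matQ_mem : matQ ∈ specialUnitaryGroup (Fin 3) ℂ := by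
  rw [mem_specialUnitaryGroup_iff, mem_unitaryGroup_iff]
  have h1 := omega_cube
  constructor
  · ext i j
    fin_cases i <;> fin_cases j <;>
      simp [matQ, Matrix.mul_apply, Fin.sum_univ_three, star_omega] <;> grind
  · simp [matQ, Matrix.det_fin_three]; grind

/-! The generators as elements of `SU(3)`. -/

noncomputable def C : specialUnitaryGroup (Fin 3) ℂ := ⟨matC, matC_mem⟩
noncomputable def E : specialUnitaryGroup (Fin 3) ℂ := ⟨matE, matE_mem⟩
noncomputable def V : specialUnitaryGroup (Fin 3) ℂ := ⟨matV, matV_mem⟩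
noncomputable def X : specialUnitaryGroup (Fin 3) ℂ := ⟨matX, matX_mem⟩
noncomputable def D : specialUnitaryGroup (Fin 3) ℂ := ⟨matD, matD_mem⟩
noncomputable def B : specialUnitaryGroup (Fin 3) ℂ := ⟨matB, matB_mem⟩
noncomputable def W : specialUnitaryGroup (Fin 3) ℂ := ⟨matW, matW_mem⟩
noncomputable def Q : specialUnitaryGroup (Fin 3) ℂ := ⟨matQ, matQ_mem⟩

/-- `Σ(108)`, also written `Σ(36 × 3)` or `Σ(36φ)`. -/
noncomputable def Sigma108 : Subgroup (specialUnitaryGroup (Fin 3) ℂ) :=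
  Subgroup.closure {C, E, V}

/-- `Σ(216)`, also written `Σ(72 × 3)` or `Σ(72φ)`. -/
noncomputable def Sigma216 : Subgroup (specialUnitaryGroup (Fin 3) ℂ) :=
  Subgroup.closure {C, E, V, X}

/-- `Σ(648)`, also written `Σ(216 × 3)` or `Σ(216φ)`. -/
noncomputable def Sigma648 : Subgroup (specialUnitaryGroup (Fin 3) ℂ) :=
  Subgroup.closure {C, E, V, D}

/-- `Σ(1080)`, also written `Σ(360 × 3)` or `Σ(360φ)`. -/
noncomputable def Sigma1080 : Subgroup (specialUnitaryGroup (Fin 3) ℂ) :=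
  Subgroup.closure {B, E, W, Q}

end CrystalLike

/-! Positive part. On a subgroup of SU(3) stable under entrywise conjugation, that conjugation is an
involutory automorphism, and it inverts symmetric elements. If g = z a b with z scalar and a, b
symmetric in the group, then conjugating z⁻¹a⁻¹b⁻¹ by a yields g⁻¹, so the automorphism is
class-inverting (`isQuasiAmbivalent_of_symm_mul_symm`). For Σ(108) and Σ(648) such factorisations
are a finite matter. Both groups normalise the Heisenberg group generated by C and E, and by Schur
an element is determined up to a scalar by its action there, a pair in SL₂(𝔽₃) ⋉ 𝔽₃². Products x y x
of symmetric elements are symmetric, and enough of them are produced to factor every action.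
Ambivalence fails because inner automorphisms fix the central element ω, whose trace 3ω is not real.

Negative part. Involutivity plays no role: no class-inverting automorphism τ exists at all.

For Σ(216), τ inverts ω, so it acts on 𝔽₃² (Heisenberg modulo centre) with determinant -1. It also
preserves the sign characters of the quaternion quotient Q₈, hence each of the three cyclic
subgroups of order four. Elements of GL₂(𝔽₃) normalising all three lie in Q₈ and have determinant 1,
a contradiction.

Σ(1080) permutes six conics, with kernel the scalars of order three, and τ preserves numbers of
fixed conics. After an inner correction τ sends U = WBE, of order five on the conics, to U or U² up
to a scalar; traces leave only τ(U) = U. Fixed-point counts of words in U and Q then make τ(Q) a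
conjugate of Q by a power of U, up to a scalar that the trace shows to be 1. So τ(UQ) is conjugate
to UQ, whose trace -μ₁ω is not real. -/

/-! ### Class-inverting automorphisms and traces -/

theorem IsClassInverting.trace_map_eq {G : Type} [Group G] {τ : MulAut G}
    (h : IsClassInverting τ) {n : ℕ} (f : G →* Matrix (Fin n) (Fin n) ℂ) (g : G) :
    (f (τ g)).trace = (f g⁻¹).trace := by
  have := h (Fin n → ℂ) ((Matrix.toLinAlgEquiv' : Matrix (Fin n) (Fin n) ℂ ≃ₐ[ℂ] _).toMonoidHom.comp f) g
  have key (A : Matrix (Fin n) (Fin n) ℂ) :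
      LinearMap.trace ℂ _ (Matrix.toLinAlgEquiv' A) = A.trace := Matrix.trace_toLin'_eq A
  rw [← key, ← key]
  exact this

theorem isClassInverting_of_conj_eq_inv {G : Type} [Group G] {τ : MulAut G}
    (h : ∀ g, ∃ x, x * τ g * x⁻¹ = g⁻¹) : IsClassInverting τ := by
  intro V _ _ _ ρ g
  obtain ⟨x, hx⟩ := h g
  rw [← hx, Representation.char_conj]

/-- Characters are class functions. Involutivity may be lost here, which is harmless because the
non-existence proofs never use it. -/
theorem IsClassInverting.conj_mul {G : Type} [Group G] {τ : MulAut G} (hτ : IsClassInverting τ)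
    (h : G) : IsClassInverting (MulAut.conj h * τ) := by
  intro V _ _ _ ρ g
  rw [← hτ V ρ g, MulAut.mul_apply, MulAut.conj_apply, Representation.char_conj]

/-! ### Complex conjugation on SU(3) and the central obstruction -/

namespace CrystalLike

/-- The special unitary group `SU(3)`. -/
abbrev SU3 := specialUnitaryGroup (Fin 3) ℂ

theorem coe_inv_eq (g : SU3) : ((g⁻¹ : SU3) : Matrix (Fin 3) (Fin 3) ℂ) = star (g : Matrix _ _ ℂ) := rfl

/-- The inclusion of a subgroup of `SU(3)` into the matrix ring. -/
def toMat (H : Subgroup SU3) : H →* Matrix (Fin 3) (Fin 3) ℂ :=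
  (specialUnitaryGroup (Fin 3) ℂ).subtype.comp H.subtype

theorem toMat_apply (H : Subgroup SU3) (g : H) : toMat H g = ((g : SU3) : Matrix (Fin 3) (Fin 3) ℂ) := rfl

theorem trace_apply_classInverting {H : Subgroup SU3} {τ : MulAut H} (h : IsClassInverting τ)
    (g : H) : (toMat H (τ g)).trace = star (toMat H g).trace := by
  rw [h.trace_map_eq, toMat_apply, toMat_apply, Subgroup.coe_inv, coe_inv_eq, star_eq_conjTranspose,
    trace_conjTranspose]

theorem map_star_mem (g : SU3) :
    (g : Matrix (Fin 3) (Fin 3) ℂ).map star ∈ specialUnitaryGroup (Fin 3) ℂ := by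
  obtain ⟨g, hg⟩ := g
  rw [mem_specialUnitaryGroup_iff, mem_unitaryGroup_iff] at *
  constructor
  · have := congrArg (fun M : Matrix (Fin 3) (Fin 3) ℂ => M.map (starRingEnd ℂ)) hg.1
    simp only [Matrix.map_mul] at this
    rw [Matrix.map_one _ (map_zero _) (map_one _)] at this
    exact this
  · have := congrArg (starRingEnd ℂ) hg.2
    rw [RingHom.map_det, map_one] at this
    exact this

/-- Entrywise complex conjugation as an automorphism of `SU(3)`. -/
noncomputable def conjEquiv : SU3 ≃* SU3 where
  toFun g := ⟨(g : Matrix (Fin 3) (Fin 3) ℂ).map star, map_star_mem g⟩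
  invFun g := ⟨(g : Matrix (Fin 3) (Fin 3) ℂ).map star, map_star_mem g⟩
  left_inv g := by ext; simp
  right_inv g := by ext; simp
  map_mul' g h := by
    apply Subtype.ext
    exact Matrix.map_mul (f := starRingEnd ℂ)

theorem conjEquiv_conjEquiv (g : SU3) : conjEquiv (conjEquiv g) = g := conjEquiv.left_inv g

theorem conjEquiv_eq_inv {g : SU3} (h : (g : Matrix (Fin 3) (Fin 3) ℂ)ᵀ = g) :
    conjEquiv g = g⁻¹ := by
  apply Subtype.ext
  rw [coe_inv_eq, star_eq_conjTranspose, conjTranspose, h]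
  rfl

theorem commute_of_eq_smul {z : SU3} {s : ℂ} (h : (z : Matrix (Fin 3) (Fin 3) ℂ) = s • 1) (g : SU3) :
    z * g = g * z := by
  apply Subtype.ext
  simp [h]

/-- A subgroup of `SU(3)` stable under complex conjugation all of whose elements are, up to
scalars, products of two symmetric elements is quasi-ambivalent. -/
theorem isQuasiAmbivalent_of_symm_mul_symm (H : Subgroup SU3)
    (hc : ∀ g ∈ H, conjEquiv g ∈ H)
    (hs : ∀ g ∈ H, ∃ a ∈ H, ∃ b ∈ H, ∃ z : SU3, ∃ s : ℂ,
      (a : Matrix (Fin 3) (Fin 3) ℂ)ᵀ = a ∧ (b : Matrix (Fin 3) (Fin 3) ℂ)ᵀ = b ∧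
      (z : Matrix (Fin 3) (Fin 3) ℂ) = s • 1 ∧ g = z * (a * b)) :
    IsQuasiAmbivalent H := by
  let τ : MulAut H :=
    { toFun := fun g => ⟨conjEquiv g, hc _ g.2⟩
      invFun := fun g => ⟨conjEquiv g, hc _ g.2⟩
      left_inv := fun g => Subtype.ext (conjEquiv_conjEquiv g)
      right_inv := fun g => Subtype.ext (conjEquiv_conjEquiv g)
      map_mul' := fun g h => Subtype.ext (map_mul conjEquiv _ _) }
  refine ⟨τ, fun g => Subtype.ext (conjEquiv_conjEquiv g), isClassInverting_of_conj_eq_inv ?_⟩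
  rintro ⟨g, hg⟩
  obtain ⟨a, ha, b, hb, z, s, hat, hbt, hz, rfl⟩ := hs g hg
  refine ⟨⟨a, ha⟩, Subtype.ext ?_⟩
  -- Conjugation inverts z, a and b, so the middle factor is z⁻¹a⁻¹b⁻¹; conjugating by a turns it
  -- into z⁻¹b⁻¹a⁻¹.
  change a * conjEquiv (z * (a * b)) * a⁻¹ = (z * (a * b))⁻¹
  have hzt : (z : Matrix (Fin 3) (Fin 3) ℂ)ᵀ = z := by rw [hz]; simp
  rw [map_mul, map_mul, conjEquiv_eq_inv hat, conjEquiv_eq_inv hbt, conjEquiv_eq_inv hzt]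
  have := commute_of_eq_smul hz
  have h1 : a * z⁻¹ = z⁻¹ * a := by
    rw [eq_inv_mul_iff_mul_eq, ← mul_assoc, this, mul_assoc, mul_inv_cancel, mul_one]
  have h2 : (a * b)⁻¹ * z⁻¹ = z⁻¹ * (a * b)⁻¹ := by
    rw [← _root_.mul_inv_rev, ← _root_.mul_inv_rev, this]
  rw [_root_.mul_inv_rev z, h2, ← mul_assoc, h1, _root_.mul_inv_rev]
  group

theorem omega_ne_one : ω ≠ 1 := by
  intro h
  have := omega_sum
  rw [h] at this
  norm_num at this

/-- A subgroup of `SU(3)` containing `ω` is not ambivalent. -/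
theorem not_isAmbivalent_of_omega_mem (H : Subgroup SU3) (z : SU3) (hz : z ∈ H)
    (h : (z : Matrix (Fin 3) (Fin 3) ℂ) = ω • 1) : ¬ IsAmbivalent H := by
  rintro ⟨τ, ⟨x, rfl⟩, -, hτ⟩
  -- An inner automorphism fixes the scalar ω, whose trace would then be real: 3ω = 3ω².
  have h1 : MulAut.conj x ⟨z, hz⟩ = ⟨z, hz⟩ := by
    apply Subtype.ext
    change (x : SU3) * z * (x : SU3)⁻¹ = z
    rw [← commute_of_eq_smul h, mul_assoc, mul_inv_cancel, mul_one]
  have h2 := trace_apply_classInverting hτ ⟨z, hz⟩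
  rw [h1, toMat_apply] at h2
  simp only [h, trace_smul, trace_one, Fintype.card_fin, smul_eq_mul, star_mul'] at h2
  change ω * ((3 : ℕ) : ℂ) = (starRingEnd ℂ) ω * _ at h2
  rw [star_omega, star_natCast] at h2
  have h3 := omega_cube
  apply omega_ne_one
  push_cast at h2
  linear_combination (-h2 * ω^2/3) + h3 - ω * h3

/-! ### The Heisenberg group of order 27 -/

theorem pow_val_add {M : Type*} [Monoid M] {x : M} (hx : x ^ 3 = 1) (a b : ZMod 3) :
    x ^ (a + b).val = x ^ a.val * x ^ b.val := by
  rw [ZMod.val_add, ← pow_add, ← pow_mod_orderOf x ((a.val + b.val) % 3),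
    ← pow_mod_orderOf x (a.val + b.val), Nat.mod_mod_of_dvd _ (orderOf_dvd_of_pow_eq_one hx)]

/-- The additive character `k ↦ ω ^ k` of `ℤ/3`. -/
noncomputable def chi (k : ZMod 3) : ℂ := ω ^ k.val

theorem chi_add (k l : ZMod 3) : chi (k + l) = chi k * chi l := pow_val_add omega_cube k l

theorem chi_zero : chi 0 = 1 := by simp [chi]

theorem chi_one : chi 1 = ω := by simp [chi, ZMod.val_one]

theorem chi_two : chi 2 = ω ^ 2 := by
  rw [show (2 : ZMod 3) = 1 + 1 from by decide, chi_add, chi_one, sq]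

theorem matC_cube : matC ^ 3 = 1 := by
  have h := omega_cube
  ext i j
  fin_cases i <;> fin_cases j <;>
    simp [matC, pow_succ, Matrix.mul_apply, Fin.sum_univ_three] <;> grind

theorem matE_cube : matE ^ 3 = 1 := by
  ext i j
  fin_cases i <;> fin_cases j <;>
    simp [matE, pow_succ, Matrix.mul_apply, Fin.sum_univ_three]

theorem matE_mul_matC : matE * matC = ω • (matC * matE) := by
  have h := omega_cube
  ext i j
  fin_cases i <;> fin_cases j <;>
    simp [matC, matE, Matrix.mul_apply, Fin.sum_univ_three] <;> grind

theorem matE_pow_mul_matC_pow (b a : ℕ) :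
    matE ^ b * matC ^ a = ω ^ (b * a) • (matC ^ a * matE ^ b) := by
  have h1 (a : ℕ) : matE * matC ^ a = ω ^ a • (matC ^ a * matE) := by
    induction a with
    | zero => simp
    | succ n ih =>
      rw [pow_succ, ← mul_assoc, ih, smul_mul_assoc, mul_assoc, matE_mul_matC, mul_smul_comm,
        smul_smul, ← mul_assoc, pow_succ ω]
  induction b with
  | zero => simp
  | succ n ih =>
    rw [pow_succ, mul_assoc, h1, mul_smul_comm, ← mul_assoc, ih, smul_mul_assoc, smul_smul,
      mul_assoc, ← pow_add]
    congr 2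
    ring

theorem chi_mul (a b : ZMod 3) : chi (a * b) = ω ^ (a.val * b.val) := by
  rw [chi, ZMod.val_mul, ← pow_mod_orderOf ω (a.val * b.val % 3),
    ← pow_mod_orderOf ω (a.val * b.val),
    Nat.mod_mod_of_dvd _ (orderOf_dvd_of_pow_eq_one omega_cube)]

/-- The elements of the Heisenberg group, symmetrized so that their product is given by `wt_mul`. -/
noncomputable def wt (a b k : ZMod 3) : Matrix (Fin 3) (Fin 3) ℂ :=
  chi (k + 2 * a * b) • (matC ^ a.val * matE ^ b.val)

/-- Reordering E^b C^a' costs the phase ba'. The correction 2ab in `wt` turns this cocycle into the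
alternating form ab' - a'b modulo 3, so that determinant-one linear maps become automorphisms. -/
theorem wt_mul (a b k a' b' k' : ZMod 3) :
    wt a b k * wt a' b' k' = wt (a + a') (b + b') (k + k' + a * b' - a' * b) := by
  have h : matE ^ b.val * matC ^ a'.val = chi (b * a') • (matC ^ a'.val * matE ^ b.val) := by
    rw [matE_pow_mul_matC_pow, chi_mul]
  simp only [wt, smul_mul_smul_comm, pow_val_add matC_cube, pow_val_add matE_cube]
  rw [mul_assoc (matC ^ a.val), ← mul_assoc (matE ^ b.val), h, smul_mul_assoc, mul_smul_comm,
    smul_smul, ← chi_add, ← chi_add]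
  simp only [mul_assoc]
  congr 2
  have h3 : (3 : ZMod 3) = 0 := by decide
  linear_combination (- a * b' ) * h3

theorem wt_zero (k : ZMod 3) : wt 0 0 k = chi k • 1 := by simp [wt]

theorem wt_pow (a b k : ZMod 3) (n : ℕ) : wt a b k ^ n = wt (n * a) (n * b) (n * k) := by
  induction n with
  | zero => simp [wt_zero, chi_zero]
  | succ n ih =>
    rw [pow_succ, ih, wt_mul]
    congr 1 <;> push_cast <;> ring

theorem wt_eq_smul (a b k : ZMod 3) :
    wt a b k = chi (k + 2 * a * b) • (wt 1 0 0 ^ a.val * wt 0 1 0 ^ b.val) := by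
  simp [wt, ZMod.val_one, chi_zero]

theorem chi_eq_one {k : ZMod 3} (h : chi k = 1) : k = 0 := by
  have h1 := omega_cube
  have h2 := omega_ne_one
  fin_cases k
  · rfl
  · exact absurd (chi_one.symm.trans h) h2
  · have h3 : ω ^ 2 = 1 := chi_two.symm.trans h
    exact absurd (by linear_combination h1 - ω * h3) h2

theorem matC_pow (n : ℕ) : matC ^ n = Matrix.diagonal ![1, ω ^ n, (ω ^ 2) ^ n] := by
  have h : matC = Matrix.diagonal ![1, ω, ω ^ 2] := by
    ext i j
    fin_cases i <;> fin_cases j <;> simp [matC]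
  rw [h, Matrix.diagonal_pow]
  congr 1
  ext i
  fin_cases i <;> simp

theorem wt_eq_one {a b k : ZMod 3} (h : wt a b k = 1) : a = 0 ∧ b = 0 ∧ k = 0 := by
  have e1 := congrFun (congrFun h 0) 0
  have e2 := congrFun (congrFun h 1) 1
  have hb : b = 0 := by
    fin_cases b
    · rfl
    · simp [wt, ZMod.val, matC_pow, matE] at e1
    · simp [wt, ZMod.val, matC_pow, matE, sq, Matrix.mul_apply, Fin.sum_univ_three] at e1
  subst hb
  simp only [wt, mul_zero, add_zero, ZMod.val_zero, pow_zero, mul_one, matC_pow] at e1 e2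
  have hk : chi k = 1 := by simpa using e1
  rw [hk] at e2
  have ha : chi a = 1 := by simpa [chi] using e2
  exact ⟨chi_eq_one ha, rfl, chi_eq_one hk⟩

theorem wt_injective {a b k a' b' k' : ZMod 3} (h : wt a b k = wt a' b' k') :
    a = a' ∧ b = b' ∧ k = k' := by
  have h1 := congrArg (· * wt (-a') (-b') (-k')) h
  simp only [wt_mul] at h1
  rw [show wt (a' + -a') (b' + -b') (k' + -k' + a' * -b' - -a' * b') = 1 from by
    ring_nf; simp [wt_zero, chi_zero]] at h1
  obtain ⟨h2, h3, h4⟩ := wt_eq_one h1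
  have h2' : a = a' := by linear_combination h2
  have h3' : b = b' := by linear_combination h3
  subst h2' h3'
  exact ⟨rfl, rfl, by linear_combination h4⟩

/-! ### Conjugation action on the Heisenberg group -/

/-- Linear automorphisms of the Heisenberg group: `(x, y, k)` is sent to
`(a x + b y, c x + d y, k + p x + q y)`. -/
@[ext] structure HeisAut where
  a : ZMod 3
  b : ZMod 3
  c : ZMod 3
  d : ZMod 3
  p : ZMod 3
  q : ZMod 3
deriving DecidableEq

namespace HeisAut

/-- Composition. -/
def mul (m n : HeisAut) : HeisAut :=
  ⟨m.a * n.a + m.b * n.c, m.a * n.b + m.b * n.d, m.c * n.a + m.d * n.c, m.c * n.b + m.d * n.d,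
    n.p + m.p * n.a + m.q * n.c, n.q + m.p * n.b + m.q * n.d⟩

instance : Mul HeisAut := ⟨mul⟩
instance : One HeisAut := ⟨⟨1, 0, 0, 1, 0, 0⟩⟩

/-- The inverse of an element of determinant one. -/
def inv (m : HeisAut) : HeisAut :=
  ⟨m.d, -m.b, -m.c, m.a, m.q * m.c - m.p * m.d, m.p * m.b - m.q * m.a⟩

/-- The determinant of the linear part. -/
def det (m : HeisAut) : ZMod 3 := m.a * m.d - m.b * m.c

theorem mul_def (m n : HeisAut) : m * n = mul m n := rfl

theorem det_mul (m n : HeisAut) : (m * n).det = m.det * n.det := by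
  simp only [mul_def, mul, det]; ring

theorem det_inv (m : HeisAut) : m.inv.det = m.det := by
  simp only [inv, det]; ring

end HeisAut

/-- `g` acts on the Heisenberg group by conjugation as `m`. -/
def Rel (g : SU3) (m : HeisAut) : Prop :=
  ∀ x y k, (g : Matrix (Fin 3) (Fin 3) ℂ) * wt x y k =
    wt (m.a * x + m.b * y) (m.c * x + m.d * y) (k + m.p * x + m.q * y) * g

theorem Rel.mul {g h : SU3} {m n : HeisAut} (hg : Rel g m) (hh : Rel h n) :
    Rel (g * h) (m * n) := by
  intro x y k
  rw [Submonoid.coe_mul, mul_assoc, hh, ← mul_assoc, hg, mul_assoc]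
  simp only [HeisAut.mul_def, HeisAut.mul]
  congr 2 <;> ring

theorem Rel.one : Rel 1 1 := by
  intro x y k
  change 1 * wt x y k = wt (1 * x + 0 * y) (0 * x + 1 * y) (k + 0 * x + 0 * y) * 1
  simp

theorem Rel.inv {g : SU3} {m : HeisAut} (hg : Rel g m) (hm : m.det = 1) : Rel g⁻¹ m.inv := by
  intro x y k
  have := hg (m.inv.a * x + m.inv.b * y) (m.inv.c * x + m.inv.d * y)
    (k + m.inv.p * x + m.inv.q * y)
  have h1 : ((g⁻¹ : SU3) : Matrix (Fin 3) (Fin 3) ℂ) * g = 1 := by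
    rw [← Submonoid.coe_mul, inv_mul_cancel]; rfl
  have h2 : (g : Matrix (Fin 3) (Fin 3) ℂ) * (g⁻¹ : SU3) = 1 := by
    rw [← Submonoid.coe_mul, mul_inv_cancel]; rfl
  have h3 : (g : Matrix (Fin 3) (Fin 3) ℂ) * wt (m.inv.a * x + m.inv.b * y)
      (m.inv.c * x + m.inv.d * y) (k + m.inv.p * x + m.inv.q * y) = wt x y k * g := by
    rw [this]
    simp only [HeisAut.inv, HeisAut.det] at *
    congr 2
    · linear_combination x * hm
    · linear_combination y * hm
    · ring
  calc _ = ((g⁻¹ : SU3) : Matrix (Fin 3) (Fin 3) ℂ) * (wt x y k * g) * (g⁻¹ : SU3) := by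
        rw [mul_assoc, mul_assoc, h2, mul_one]
    _ = _ := by rw [← h3, ← mul_assoc, h1, one_mul]

/-- Determinant one preserves the alternating form in `wt_mul`, so the relation propagates from the
two generators to all `wt x y k`. -/
theorem Rel.of_generators {g : SU3} {m : HeisAut} (hm : m.det = 1)
    (h1 : (g : Matrix (Fin 3) (Fin 3) ℂ) * wt 1 0 0 = wt m.a m.c m.p * g)
    (h2 : (g : Matrix (Fin 3) (Fin 3) ℂ) * wt 0 1 0 = wt m.b m.d m.q * g) : Rel g m := by
  intro x y k
  have hp {A B M : Matrix (Fin 3) (Fin 3) ℂ} (h : M * A = B * M) (n : ℕ) :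
      M * A ^ n = B ^ n * M := (SemiconjBy.pow_right h n)
  rw [wt_eq_smul x y k, mul_smul_comm, ← mul_assoc (g : Matrix (Fin 3) (Fin 3) ℂ), hp h1,
    mul_assoc _ (g : Matrix (Fin 3) (Fin 3) ℂ), hp h2, ← mul_assoc, wt_pow,
    wt_pow, wt_mul, ← smul_mul_assoc]
  congr 1
  rw [← one_mul (wt (_ + _) _ _), ← smul_mul_assoc, ← wt_zero, wt_mul]
  simp only [ZMod.natCast_val, ZMod.cast_id', id_eq, HeisAut.det] at *
  have h3 : (3 : ZMod 3) = 0 := by decide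
  congr 1
  · ring
  · ring
  · linear_combination (x * y) * hm + (x * y) * h3

theorem wt_one_zero : wt 1 0 0 = matC := by simp [wt, chi_zero, ZMod.val_one]
theorem wt_zero_one : wt 0 1 0 = matE := by simp [wt, chi_zero, ZMod.val_one]

/-- Schur's lemma by hand: commuting with the cyclic shift makes M circulant, and commuting with C,
which has distinct eigenvalues, kills the entries (0,1) and (0,2). -/
theorem eq_smul_one_of_commute {M : Matrix (Fin 3) (Fin 3) ℂ} (h1 : M * matC = matC * M)
    (h2 : M * matE = matE * M) : M = M 0 0 • 1 := by
  have h0 := omega_cube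
  have hn := omega_ne_one
  have hn2 : ω ^ 2 ≠ 1 := fun h => hn (by linear_combination h0 - ω * h)
  have e (i j : Fin 3) := congrFun (congrFun h1 i) j
  have f (i j : Fin 3) := congrFun (congrFun h2 i) j
  have e01 := e 0 1
  have e02 := e 0 2
  have f01 := f 0 1
  have f12 := f 1 2
  have f00 := f 0 0
  have f10 := f 1 0
  have f11 := f 1 1
  have f02 := f 0 2
  simp only [matC, matE, Matrix.mul_apply, Fin.sum_univ_three, Matrix.of_apply, Matrix.cons_val] at e01 e02 f01 f12 f00 f10 f11 f02
  have g01 : M 0 1 = 0 := by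
    by_contra h
    exact hn (mul_left_cancel₀ h (by linear_combination e01))
  have g02 : M 0 2 = 0 := by
    by_contra h
    exact hn2 (mul_left_cancel₀ h (by linear_combination e02))
  ext i j
  fin_cases i <;> fin_cases j <;> simp <;> grind

/-- Elements acting alike on the Heisenberg group differ by a scalar. -/
theorem Rel.eq_smul_mul {g h : SU3} {m : HeisAut} (hg : Rel g m) (hh : Rel h m) :
    ∃ z : SU3, ∃ s : ℂ, (z : Matrix (Fin 3) (Fin 3) ℂ) = s • 1 ∧ g = z * h := by
  have h1 : ((h⁻¹ : SU3) : Matrix (Fin 3) (Fin 3) ℂ) * h = 1 := by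
    rw [← Submonoid.coe_mul, inv_mul_cancel]; rfl
  have h2 : (h : Matrix (Fin 3) (Fin 3) ℂ) * (h⁻¹ : SU3) = 1 := by
    rw [← Submonoid.coe_mul, mul_inv_cancel]; rfl
  have key (x y k : ZMod 3) : ((h⁻¹ * g : SU3) : Matrix (Fin 3) (Fin 3) ℂ) * wt x y k =
      wt x y k * (h⁻¹ * g : SU3) := by
    have h3 : wt x y k * ((h⁻¹ : SU3) : Matrix (Fin 3) (Fin 3) ℂ) = (h⁻¹ : SU3) *
        wt (m.a * x + m.b * y) (m.c * x + m.d * y) (k + m.p * x + m.q * y) := by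
      calc _ = ((h⁻¹ : SU3) : Matrix (Fin 3) (Fin 3) ℂ) * (h * wt x y k) * (h⁻¹ : SU3) := by
            rw [← mul_assoc, h1, one_mul]
        _ = _ := by rw [hh, mul_assoc, mul_assoc, h2, mul_one]
    rw [Submonoid.coe_mul, ← mul_assoc (wt x y k), h3, mul_assoc, hg, ← mul_assoc]
  have hz := eq_smul_one_of_commute (wt_one_zero ▸ key 1 0 0) (wt_zero_one ▸ key 0 1 0)
  refine ⟨h⁻¹ * g, _, hz, ?_⟩
  rw [commute_of_eq_smul hz, mul_inv_cancel_left]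

theorem Rel.unique {g : SU3} {m n : HeisAut} (hm : Rel g m) (hn : Rel g n) : m = n := by
  have key {x y k x' y' k' : ZMod 3}
      (h : wt x y k * (g : Matrix (Fin 3) (Fin 3) ℂ) = wt x' y' k' * g) : 
      x = x' ∧ y = y' ∧ k = k' := by
    apply wt_injective
    have h2 : (g : Matrix (Fin 3) (Fin 3) ℂ) * (g⁻¹ : SU3) = 1 := by
      rw [← Submonoid.coe_mul, mul_inv_cancel]; rfl
    simpa [mul_assoc, h2] using congrArg (· * ((g⁻¹ : SU3) : Matrix (Fin 3) (Fin 3) ℂ)) h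
  have h1 := key ((hm 1 0 0).symm.trans (hn 1 0 0))
  have h2 := key ((hm 0 1 0).symm.trans (hn 0 1 0))
  simp only [mul_one, mul_zero, add_zero, zero_add] at h1 h2
  exact HeisAut.ext h1.1 h2.1 h1.2.1 h2.2.1 h1.2.2 h2.2.2

theorem rel_C : Rel C ⟨1, 0, 0, 1, 0, 2⟩ := by
  refine Rel.of_generators (by decide) ?_ ?_
  · simp [C, wt_one_zero]
  · have h : wt 0 1 2 = ω ^ 2 • matE := by simp [wt, chi_two, ZMod.val_one]
    have h0 := omega_cube
    simp only [wt_zero_one, C, h]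
    ext i j
    fin_cases i <;> fin_cases j <;>
      simp [matC, matE, Matrix.mul_apply, Fin.sum_univ_three] <;> grind

theorem rel_E : Rel E ⟨1, 0, 0, 1, 1, 0⟩ := by
  refine Rel.of_generators (by decide) ?_ ?_
  · have h : wt 1 0 1 = ω • matC := by simp [wt, chi_one, ZMod.val_one]
    simp only [wt_one_zero, E, h, matE_mul_matC, smul_mul_assoc]
  · simp [E, wt_zero_one]

theorem rel_V : Rel V ⟨0, 2, 1, 0, 0, 0⟩ := by
  have h0 := omega_cube
  refine Rel.of_generators (by decide) ?_ ?_
  · simp only [wt_one_zero, wt_zero_one, V]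
    ext i j
    fin_cases i <;> fin_cases j <;>
      simp [matC, matE, matV, Matrix.mul_apply, Fin.sum_univ_three] <;> grind
  · have h : wt 2 0 0 = matC ^ 2 := by simp [wt, chi_zero, show (2 : ZMod 3).val = 2 from rfl]
    simp only [wt_zero_one, V, h]
    ext i j
    fin_cases i <;> fin_cases j <;>
      simp [matC, matE, matV, sq, Matrix.mul_apply, Fin.sum_univ_three] <;> grind

theorem rel_X : Rel X ⟨2, 1, 1, 1, 2, 0⟩ := by
  have h0 := omega_cube
  refine Rel.of_generators (by decide) ?_ ?_
  · have h : wt 2 1 2 = matC ^ 2 * matE := by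
      simp [wt, show (2 + 2 * 2 : ZMod 3) = 0 from by decide, chi_zero,
        show (2 : ZMod 3).val = 2 from rfl, ZMod.val_one]
    simp only [wt_one_zero, X, h]
    ext i j
    fin_cases i <;> fin_cases j <;>
      simp [matC, matE, matX, sq, Matrix.mul_apply, Fin.sum_univ_three] <;> grind
  · have h : wt 1 1 0 = ω ^ 2 • (matC * matE) := by simp [wt, chi_two, ZMod.val_one]
    simp only [wt_zero_one, X, h]
    ext i j
    fin_cases i <;> fin_cases j <;>
      simp [matC, matE, matX, Matrix.mul_apply, Fin.sum_univ_three] <;> grind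

theorem rel_D : Rel D ⟨1, 2, 0, 1, 0, 2⟩ := by
  have h0 := omega_cube
  refine Rel.of_generators (by decide) ?_ ?_
  · simp only [wt_one_zero, D]
    ext i j
    fin_cases i <;> fin_cases j <;>
      simp [matC, matD, Matrix.mul_apply, Fin.sum_univ_three] <;> grind
  · have h : wt 2 1 2 = matC ^ 2 * matE := by
      simp [wt, show (2 + 2 * 2 : ZMod 3) = 0 from by decide, chi_zero,
        show (2 : ZMod 3).val = 2 from rfl, ZMod.val_one]
    simp only [wt_zero_one, D, h]
    ext i j
    fin_cases i <;> fin_cases j <;>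
      simp [matC, matE, matD, sq, Matrix.mul_apply, Fin.sum_univ_three] <;> grind

theorem exists_rel_of_mem_closure {S : Set SU3} {P : HeisAut → Prop} (one : P 1)
    (mul : ∀ m n, P m → P n → P (m * n)) (inv : ∀ m, P m → P m.inv) (det : ∀ m, P m → m.det = 1)
    (gen : ∀ g ∈ S, ∃ m, P m ∧ Rel g m) {g : SU3} (hg : g ∈ Subgroup.closure S) :
    ∃ m, P m ∧ Rel g m := by
  induction hg using Subgroup.closure_induction with
  | mem g hg => exact gen g hg
  | one => exact ⟨1, one, Rel.one⟩
  | mul g h _ _ ihg ihh =>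
    obtain ⟨m, hm, rm⟩ := ihg
    obtain ⟨n, hn, rn⟩ := ihh
    exact ⟨m * n, mul m n hm hn, rm.mul rn⟩
  | inv g _ ih =>
    obtain ⟨m, hm, rm⟩ := ih
    exact ⟨m.inv, inv m hm, rm.inv (det m hm)⟩

/-! ### Symmetric factorisations in Σ(108) and Σ(648) -/

/-- The linear part lies in the cyclic group of order four generated by that of `V`. -/
def HeisAut.IsRotation (m : HeisAut) : Prop := m.d = m.a ∧ m.c = -m.b ∧ m.det = 1

theorem exists_rel_108 {g : SU3} (hg : g ∈ Sigma108) : ∃ m : HeisAut, m.IsRotation ∧ Rel g m := by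
  refine exists_rel_of_mem_closure ⟨rfl, rfl, rfl⟩ ?_ ?_ (fun m h => h.2.2) ?_ hg
  · rintro m n ⟨h1, h2, h3⟩ ⟨k1, k2, k3⟩
    refine ⟨?_, ?_, by rw [HeisAut.det_mul, h3, k3, one_mul]⟩ <;>
    · simp only [HeisAut.mul_def, HeisAut.mul, h1, h2, k1, k2]; ring
  · rintro m ⟨h1, h2, h3⟩
    refine ⟨?_, ?_, by rw [HeisAut.det_inv, h3]⟩ <;> simp [HeisAut.inv, h1, h2]
  · rintro g (rfl | rfl | rfl)
    · exact ⟨_, by unfold HeisAut.IsRotation; decide, rel_C⟩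
    · exact ⟨_, by unfold HeisAut.IsRotation; decide, rel_E⟩
    · exact ⟨_, by unfold HeisAut.IsRotation; decide, rel_V⟩

theorem exists_rel_648 {g : SU3} (hg : g ∈ Sigma648) : ∃ m : HeisAut, m.det = 1 ∧ Rel g m := by
  refine exists_rel_of_mem_closure (P := fun m => m.det = 1) rfl ?_ ?_ (fun m h => h) ?_ hg
  · intro m n h k
    rw [HeisAut.det_mul, h, k, one_mul]
  · intro m h
    rw [HeisAut.det_inv, h]
  · rintro g (rfl | rfl | rfl | rfl)
    · exact ⟨_, by decide, rel_C⟩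
    · exact ⟨_, by decide, rel_E⟩
    · exact ⟨_, by decide, rel_V⟩
    · exact ⟨_, by decide, rel_D⟩

/-- `m` is the action of a symmetric element of `H`. -/
def HasSymm (H : Subgroup SU3) (m : HeisAut) : Prop :=
  ∃ g ∈ H, (g : Matrix (Fin 3) (Fin 3) ℂ)ᵀ = g ∧ Rel g m

theorem HasSymm.sandwich {H : Subgroup SU3} {m n : HeisAut} (hm : HasSymm H m)
    (hn : HasSymm H n) : HasSymm H (m * n * m) := by
  obtain ⟨g, hg, gt, gr⟩ := hm
  obtain ⟨h, hh, ht, hr⟩ := hn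
  refine ⟨g * h * g, H.mul_mem (H.mul_mem hg hh) hg, ?_, (gr.mul hr).mul gr⟩
  simp [gt, ht, mul_assoc]

theorem HasSymm.one (H : Subgroup SU3) : HasSymm H 1 :=
  ⟨1, H.one_mem, by simp, Rel.one⟩

/-- Extend a list by the products `x * y * x` for the given pairs of positions of `x` and `y`. -/
def sandwiches : List HeisAut → List (ℕ × ℕ) → List HeisAut
  | L, [] => L
  | L, (i, j) :: t => sandwiches (L ++ [L.getD i 1 * L.getD j 1 * L.getD i 1]) t

theorem hasSymm_of_mem_sandwiches {H : Subgroup SU3} (t : List (ℕ × ℕ)) :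
    ∀ L : List HeisAut, (∀ m ∈ L, HasSymm H m) → ∀ m ∈ sandwiches L t, HasSymm H m := by
  induction t with
  | nil => exact fun L h => h
  | cons ij t ih =>
    intro L h
    refine ih _ ?_
    have key (i : ℕ) : HasSymm H (L.getD i 1) := by
      rw [List.getD_eq_getElem?_getD]
      cases hi : L[i]? with
      -- An index out of range gives the default 1, which is symmetric as well, so no bounds need
      -- checking.
      | none => exact HasSymm.one H
      | some m => exact h m (List.mem_of_getElem? hi)
    intro m hm
    rcases List.mem_append.1 hm with hm | hm
    · exact h m hm
    · rw [List.mem_singleton.1 hm]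
      exact (key _).sandwich (key _)

theorem isQuasiAmbivalent_of_rel (H : Subgroup SU3) (hc : ∀ g ∈ H, conjEquiv g ∈ H)
    (hs : ∀ g ∈ H, ∃ m n, HasSymm H m ∧ HasSymm H n ∧ Rel g (m * n)) : IsQuasiAmbivalent H := by
  refine isQuasiAmbivalent_of_symm_mul_symm H hc fun g hg => ?_
  obtain ⟨m, n, ⟨a, ha, hat, ra⟩, ⟨b, hb, hbt, rb⟩, hr⟩ := hs g hg
  obtain ⟨z, s, hz, h⟩ := hr.eq_smul_mul (ra.mul rb)
  exact ⟨a, ha, b, hb, z, s, hat, hbt, hz, h⟩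

theorem transpose_C : (C : Matrix (Fin 3) (Fin 3) ℂ)ᵀ = C := by
  ext i j
  fin_cases i <;> fin_cases j <;> simp [C, matC]

theorem transpose_V : (V : Matrix (Fin 3) (Fin 3) ℂ)ᵀ = V := by
  ext i j
  fin_cases i <;> fin_cases j <;> simp [V, matV]

theorem transpose_D : (D : Matrix (Fin 3) (Fin 3) ℂ)ᵀ = D := by
  ext i j
  fin_cases i <;> fin_cases j <;> simp [D, matD]

theorem transpose_CD : ((C * D : SU3) : Matrix (Fin 3) (Fin 3) ℂ)ᵀ = (C * D : SU3) := by
  ext i j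
  fin_cases i <;> fin_cases j <;>
    simp [C, D, matC, matD]

theorem rel_CD : Rel (C * D) ⟨1, 2, 0, 1, 0, 1⟩ := by
  have h : (⟨1, 0, 0, 1, 0, 2⟩ * ⟨1, 2, 0, 1, 0, 2⟩ : HeisAut) = ⟨1, 2, 0, 1, 0, 1⟩ := by decide
  exact h ▸ rel_C.mul rel_D

theorem conjEquiv_E : conjEquiv E = E := by
  apply Subtype.ext
  change matE.map star = matE
  ext i j
  fin_cases i <;> fin_cases j <;> simp [matE]

theorem conjEquiv_mem_closure {S : Set SU3} (h : ∀ g ∈ S, conjEquiv g ∈ Subgroup.closure S) :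
    ∀ g ∈ Subgroup.closure S, conjEquiv g ∈ Subgroup.closure S := by
  have : Subgroup.closure S ≤ (Subgroup.closure S).comap conjEquiv.toMonoidHom := by
    rw [Subgroup.closure_le]
    exact h
  exact fun g hg => this hg

/-- The seeds are the actions of 1, C and V. The pairs index the growing list and are chosen so that
`exists_symm108` holds. -/
def symm108 : List HeisAut :=
  sandwiches [1, ⟨1, 0, 0, 1, 0, 2⟩, ⟨0, 2, 1, 0, 0, 0⟩]
    [(1, 0), (1, 2), (2, 0), (2, 1), (2, 2), (2, 3), (2, 4), (1, 4), (1, 7)]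

/-- The seeds are the actions of 1, C, V, D and CD; the last is symmetric because C and D are
diagonal. -/
def symm648 : List HeisAut :=
  sandwiches [1, ⟨1, 0, 0, 1, 0, 2⟩, ⟨0, 2, 1, 0, 0, 0⟩, ⟨1, 2, 0, 1, 0, 2⟩, ⟨1, 2, 0, 1, 0, 1⟩]
    [(1, 0), (1, 2), (1, 3), (2, 0), (2, 1), (2, 2), (2, 3), (2, 4), (2, 5), (2, 6), (2, 7),
      (3, 0), (3, 1), (3, 2), (3, 5), (3, 6), (3, 8), (3, 9), (3, 10), (3, 13), (3, 14), (3, 15),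
      (4, 6), (4, 10), (4, 18), (4, 20), (4, 21), (4, 22), (4, 24), (1, 6), (1, 30)]

/-- A check of 36 actions: four rotations and nine pairs (p, q). In `exists_symm648` there are 24 ·
9 = 216. -/
theorem exists_symm108 : ∀ a b c d p q : ZMod 3, d = a → c = -b → a * d - b * c = 1 →
    ∃ m ∈ symm108, ∃ n ∈ symm108, (⟨a, b, c, d, p, q⟩ : HeisAut) = m * n := by
  decide +kernel

theorem exists_symm648 : ∀ a b c d p q : ZMod 3, a * d - b * c = 1 →
    ∃ m ∈ symm648, ∃ n ∈ symm648, (⟨a, b, c, d, p, q⟩ : HeisAut) = m * n := by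
  decide +kernel

theorem omega_mem {H : Subgroup SU3} (hC : C ∈ H) (hE : E ∈ H) :
    ∃ z ∈ H, (z : Matrix (Fin 3) (Fin 3) ℂ) = ω • 1 := by
  refine ⟨E * C * (C * E)⁻¹, H.mul_mem (H.mul_mem hE hC) (H.inv_mem (H.mul_mem hC hE)), ?_⟩
  have h : ((E * C : SU3) : Matrix (Fin 3) (Fin 3) ℂ) = ω • ((C * E : SU3) : Matrix _ _ ℂ) :=
    matE_mul_matC
  rw [Submonoid.coe_mul, h, smul_mul_assoc, ← Submonoid.coe_mul, mul_inv_cancel]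
  rfl

theorem isQuasiAmbivalent_Sigma108 : IsQuasiAmbivalent Sigma108 := by
  have hC : C ∈ Sigma108 := Subgroup.subset_closure (by simp)
  have hE : E ∈ Sigma108 := Subgroup.subset_closure (by simp)
  have hV : V ∈ Sigma108 := Subgroup.subset_closure (by simp)
  refine isQuasiAmbivalent_of_rel _ (conjEquiv_mem_closure ?_) fun g hg => ?_
  · rintro g (rfl | rfl | rfl)
    · rw [conjEquiv_eq_inv transpose_C]; exact Subgroup.inv_mem _ hC
    · rw [conjEquiv_E]; exact hE
    · rw [conjEquiv_eq_inv transpose_V]; exact Subgroup.inv_mem _ hV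
  · have key : ∀ m ∈ symm108, HasSymm Sigma108 m := by
      refine hasSymm_of_mem_sandwiches _ _ ?_
      simp only [List.forall_mem_cons]
      exact ⟨HasSymm.one _, ⟨C, hC, transpose_C, rel_C⟩, ⟨V, hV, transpose_V, rel_V⟩, by simp⟩
    obtain ⟨m, ⟨h1, h2, h3⟩, hm⟩ := exists_rel_108 hg
    obtain ⟨x, hx, y, hy, h⟩ := exists_symm108 m.a m.b m.c m.d m.p m.q h1 h2 h3
    exact ⟨x, y, key x hx, key y hy, h ▸ hm⟩

theorem isQuasiAmbivalent_Sigma648 : IsQuasiAmbivalent Sigma648 := by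
  have hC : C ∈ Sigma648 := Subgroup.subset_closure (by simp)
  have hE : E ∈ Sigma648 := Subgroup.subset_closure (by simp)
  have hV : V ∈ Sigma648 := Subgroup.subset_closure (by simp)
  have hD : D ∈ Sigma648 := Subgroup.subset_closure (by simp)
  refine isQuasiAmbivalent_of_rel _ (conjEquiv_mem_closure ?_) fun g hg => ?_
  · rintro g (rfl | rfl | rfl | rfl)
    · rw [conjEquiv_eq_inv transpose_C]; exact Subgroup.inv_mem _ hC
    · rw [conjEquiv_E]; exact hE
    · rw [conjEquiv_eq_inv transpose_V]; exact Subgroup.inv_mem _ hV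
    · rw [conjEquiv_eq_inv transpose_D]; exact Subgroup.inv_mem _ hD
  · have key : ∀ m ∈ symm648, HasSymm Sigma648 m := by
      refine hasSymm_of_mem_sandwiches _ _ ?_
      simp only [List.forall_mem_cons]
      exact ⟨HasSymm.one _, ⟨C, hC, transpose_C, rel_C⟩, ⟨V, hV, transpose_V, rel_V⟩,
        ⟨D, hD, transpose_D, rel_D⟩,
        ⟨C * D, Subgroup.mul_mem _ hC hD, transpose_CD, rel_CD⟩, by simp⟩
    obtain ⟨m, h3, hm⟩ := exists_rel_648 hg
    obtain ⟨x, hx, y, hy, h⟩ := exists_symm648 m.a m.b m.c m.d m.p m.q h3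
    exact ⟨x, y, key x hx, key y hy, h ▸ hm⟩

theorem not_isAmbivalent_Sigma108 : ¬ IsAmbivalent Sigma108 := by
  obtain ⟨z, hz, h⟩ := omega_mem (H := Sigma108) (Subgroup.subset_closure (by simp))
    (Subgroup.subset_closure (by simp))
  exact not_isAmbivalent_of_omega_mem _ z hz h

theorem not_isAmbivalent_Sigma648 : ¬ IsAmbivalent Sigma648 := by
  obtain ⟨z, hz, h⟩ := omega_mem (H := Sigma648) (Subgroup.subset_closure (by simp))
    (Subgroup.subset_closure (by simp))
  exact not_isAmbivalent_of_omega_mem _ z hz h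

/-! ### Σ(216): sign characters against the inversion of ω -/

/-- The linear part lies in the quaternion group. -/
def HeisAut.IsQuat (m : HeisAut) : Prop :=
  m.det = 1 ∧ (m.a + m.d = 0 ∨ m.b = 0 ∧ m.c = 0)

/-- In SL₂(𝔽₃) the elements of trace zero are those of order four; with ±1 they form the normal
subgroup Q₈. -/
theorem HeisAut.IsQuat.mul {m n : HeisAut} (hm : m.IsQuat) (hn : n.IsQuat) : (m * n).IsQuat := by
  refine ⟨by rw [HeisAut.det_mul, hm.1, hn.1, one_mul], ?_⟩
  have key : ∀ a b c d : ZMod 3, a * d - b * c = 1 → (a + d = 0 ∨ b = 0 ∧ c = 0) →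
      ∀ x y z w : ZMod 3, x * w - y * z = 1 → (x + w = 0 ∨ y = 0 ∧ z = 0) →
      (a * x + b * z) + (c * y + d * w) = 0 ∨ a * y + b * w = 0 ∧ c * x + d * z = 0 := by
    decide +kernel
  exact key _ _ _ _ hm.1 hm.2 _ _ _ _ hn.1 hn.2

theorem HeisAut.IsQuat.inv {m : HeisAut} (hm : m.IsQuat) : m.inv.IsQuat := by
  refine ⟨by rw [HeisAut.det_inv, hm.1], ?_⟩
  rcases hm.2 with h | ⟨h1, h2⟩
  · exact Or.inl (by simp only [HeisAut.inv]; rw [add_comm]; exact h)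
  · exact Or.inr (by simp [HeisAut.inv, h1, h2])

theorem exists_rel_216 {g : SU3} (hg : g ∈ Sigma216) : ∃ m : HeisAut, m.IsQuat ∧ Rel g m := by
  refine exists_rel_of_mem_closure (P := HeisAut.IsQuat) ⟨rfl, Or.inr ⟨rfl, rfl⟩⟩
    (fun m n h k => h.mul k) (fun m h => h.inv) (fun m h => h.1) ?_ hg
  rintro g (rfl | rfl | rfl | rfl)
  · exact ⟨_, by unfold HeisAut.IsQuat; decide, rel_C⟩
  · exact ⟨_, by unfold HeisAut.IsQuat; decide, rel_E⟩
  · exact ⟨_, by unfold HeisAut.IsQuat; decide, rel_V⟩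
  · exact ⟨_, by unfold HeisAut.IsQuat; decide, rel_X⟩

/-- The action of an element of `Σ(216)` on the Heisenberg group. -/
noncomputable def act216 (g : Sigma216) : HeisAut := (exists_rel_216 g.2).choose

theorem isQuat_act216 (g : Sigma216) : (act216 g).IsQuat := (exists_rel_216 g.2).choose_spec.1

theorem rel_act216 (g : Sigma216) : Rel g (act216 g) := (exists_rel_216 g.2).choose_spec.2

theorem act216_eq {g : Sigma216} {m : HeisAut} (h : Rel g m) : act216 g = m :=
  (rel_act216 g).unique h

theorem act216_one : act216 1 = 1 := act216_eq Rel.one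

theorem act216_mul (g h : Sigma216) : act216 (g * h) = act216 g * act216 h :=
  act216_eq ((rel_act216 g).mul (rel_act216 h))

/-- The sign character of the quaternion group with `V` in its kernel. -/
def signV (m : HeisAut) : ℤ := if m.d = m.a ∧ m.c = -m.b then 1 else -1

/-- The sign character of the quaternion group with `X` in its kernel. -/
def signX (m : HeisAut) : ℤ := if m.b = 0 ∧ m.c = 0 ∨ m.b = m.c ∧ m.a = -m.b then 1 else -1

theorem signV_mul {m n : HeisAut} (hm : m.IsQuat) (hn : n.IsQuat) :
    signV (m * n) = signV m * signV n := by
  have key : ∀ a b c d : ZMod 3, a * d - b * c = 1 → (a + d = 0 ∨ b = 0 ∧ c = 0) →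
      ∀ x y z w : ZMod 3, x * w - y * z = 1 → (x + w = 0 ∨ y = 0 ∧ z = 0) →
      signV ⟨a * x + b * z, a * y + b * w, c * x + d * z, c * y + d * w, 0, 0⟩ =
        signV ⟨a, b, c, d, 0, 0⟩ * signV ⟨x, y, z, w, 0, 0⟩ := by
    decide +kernel
  -- The sign ignores p and q, so the check with both equal to 0 suffices by definitional unfolding.
  exact key _ _ _ _ hm.1 hm.2 _ _ _ _ hn.1 hn.2

theorem signX_mul {m n : HeisAut} (hm : m.IsQuat) (hn : n.IsQuat) :
    signX (m * n) = signX m * signX n := by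
  have key : ∀ a b c d : ZMod 3, a * d - b * c = 1 → (a + d = 0 ∨ b = 0 ∧ c = 0) →
      ∀ x y z w : ZMod 3, x * w - y * z = 1 → (x + w = 0 ∨ y = 0 ∧ z = 0) →
      signX ⟨a * x + b * z, a * y + b * w, c * x + d * z, c * y + d * w, 0, 0⟩ =
        signX ⟨a, b, c, d, 0, 0⟩ * signX ⟨x, y, z, w, 0, 0⟩ := by
    decide +kernel
  exact key _ _ _ _ hm.1 hm.2 _ _ _ _ hn.1 hn.2

/-- A character with values ±1 agrees with its inverse, so a class-inverting automorphism preserves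
it. -/
theorem sign_act216_apply {τ : MulAut Sigma216} (hτ : IsClassInverting τ)
    (l : HeisAut → ℤ) (one : l 1 = 1) (unit : ∀ m, l m = 1 ∨ l m = -1)
    (mul : ∀ {m n : HeisAut}, m.IsQuat → n.IsQuat → l (m * n) = l m * l n) (g : Sigma216) :
    l (act216 (τ g)) = l (act216 g) := by
  let f : Sigma216 →* Matrix (Fin 1) (Fin 1) ℂ :=
    { toFun := fun g => Matrix.of fun _ _ => (l (act216 g) : ℂ)
      map_one' := by
        ext i j
        simp [act216_one, one, Matrix.one_apply, Subsingleton.elim i j]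
      map_mul' := fun g h => by
        ext i j
        simp [act216_mul, mul (isQuat_act216 g) (isQuat_act216 h), Matrix.mul_apply] }
  have h1 : (l (act216 (τ g)) : ℂ) = l (act216 g⁻¹) := by
    simpa [f, Matrix.trace] using hτ.trace_map_eq f g
  have h2 : l (act216 g⁻¹) * l (act216 g) = 1 := by
    rw [← mul (isQuat_act216 _) (isQuat_act216 _), ← act216_mul, inv_mul_cancel, act216_one, one]
  have h3 : l (act216 (τ g)) = l (act216 g⁻¹) := by exact_mod_cast h1
  rw [h3]
  rcases unit (act216 g⁻¹) with h | h <;> rcases unit (act216 g) with h' | h' <;>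
    rw [h, h'] at h2 ⊢ <;> simp at h2

theorem coe_mul_coe_inv (g : SU3) : (g : Matrix (Fin 3) (Fin 3) ℂ) * (g⁻¹ : SU3) = 1 := by
  rw [← Submonoid.coe_mul, mul_inv_cancel]; rfl

/-- An element acting on the Heisenberg group by an inner automorphism is a multiple of a
Heisenberg element. -/
theorem Rel.eq_smul_wt {g : SU3} {p q : ZMod 3} (h : Rel g ⟨1, 0, 0, 1, p, q⟩) :
    ∃ s : ℂ, (g : Matrix (Fin 3) (Fin 3) ℂ) = s • wt (2 * q) p 0 := by
  have h3 : (3 : ZMod 3) = 0 := by decide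
  -- Conjugation by `wt a b 0` multiplies `wt x y 0` by `chi (2 * (a * y - b * x))`; matching px +
  -- qy modulo 3 gives a = 2q and b = p.
  have key (x y : ZMod 3) : wt (-(2 * q)) (-p) 0 * (g : Matrix (Fin 3) (Fin 3) ℂ) * wt x y 0 =
      wt x y 0 * (wt (-(2 * q)) (-p) 0 * g) := by
    rw [mul_assoc, h, ← mul_assoc, ← mul_assoc, wt_mul, wt_mul]
    congr 2
    · ring
    · ring
    · linear_combination (- q * y + p * x) * h3
  have hz := eq_smul_one_of_commute (wt_one_zero ▸ key 1 0) (wt_zero_one ▸ key 0 1)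
  refine ⟨(wt (-(2 * q)) (-p) 0 * (g : Matrix (Fin 3) (Fin 3) ℂ)) 0 0, ?_⟩
  have := congrArg (wt (2 * q) p 0 * ·) hz
  simp only [mul_smul_comm, mul_one, ← mul_assoc, wt_mul] at this
  rw [← this]
  ring_nf
  simp [wt_zero, chi_zero]

theorem eq_one_of_eq_smul {g : SU3} {r : ℂ}
    (h : (g : Matrix (Fin 3) (Fin 3) ℂ) = r • (g : Matrix (Fin 3) (Fin 3) ℂ)) : r = 1 := by
  have h1 := congrArg (fun M : Matrix (Fin 3) (Fin 3) ℂ =>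
    (M * ((g⁻¹ : SU3) : Matrix (Fin 3) (Fin 3) ℂ)) 0 0) h
  simpa only [smul_mul_assoc, coe_mul_coe_inv, Matrix.smul_apply, Matrix.one_apply_eq, smul_eq_mul,
    mul_one] using h1.symm

/-- A class-inverting automorphism inverts `ω`. -/
theorem coe_apply_eq_of_coe_eq_omega {H : Subgroup SU3} (hC : C ∈ H) (hE : E ∈ H) {τ : MulAut H}
    (hτ : IsClassInverting τ) {z : H} (hz : (z : Matrix (Fin 3) (Fin 3) ℂ) = ω • 1) :
    ((τ z : SU3) : Matrix (Fin 3) (Fin 3) ℂ) = ω ^ 2 • 1 := by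
  have hc (g : H) : τ z * g = g * τ z := by
    obtain ⟨g, rfl⟩ := τ.surjective g
    rw [← map_mul, ← map_mul]
    congr 1
    exact Subtype.ext (commute_of_eq_smul hz g)
  have hs := eq_smul_one_of_commute (M := ((τ z : SU3) : Matrix (Fin 3) (Fin 3) ℂ))
    (congrArg (toMat H) (hc ⟨C, hC⟩)) (congrArg (toMat H) (hc ⟨E, hE⟩))
  have ht := trace_apply_classInverting hτ z
  rw [toMat_apply, toMat_apply, hs, hz] at ht
  simp only [trace_smul, trace_one, Fintype.card_fin, smul_eq_mul, star_mul'] at ht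
  change _ = (starRingEnd ℂ) ω * _ at ht
  rw [star_omega, star_natCast] at ht
  rw [hs, mul_right_cancel₀ (by norm_num) ht]

theorem coe_C : (C : Matrix (Fin 3) (Fin 3) ℂ) = matC := rfl
theorem coe_E : (E : Matrix (Fin 3) (Fin 3) ℂ) = matE := rfl

theorem V_mul_C : V * C = E * V := by
  apply Subtype.ext
  simpa [coe_C, coe_E, wt_one_zero, wt_zero_one] using rel_V 1 0 0

theorem wt_eq (a b k : ZMod 3) : wt a b k = chi (k + 2 * a * b) • (matC ^ a.val * matE ^ b.val) :=
  rfl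

theorem X_mul_C : X * C = C * C * E * X := by
  apply Subtype.ext
  have := rel_X 1 0 0
  simp only [mul_zero, mul_one, add_zero, zero_add, wt_one_zero] at this
  simpa [coe_C, coe_E, wt_eq, chi_zero, show (2 : ZMod 3).val = 2 from rfl, sq, ZMod.val_one,
    show (2 + 2 * 2 : ZMod 3) = 0 from by decide] using this

/-- Q₈ has no element of order three. Hence τ maps C and E to multiples of Heisenberg elements. -/
theorem HeisAut.eq_of_cube_eq_one {m : HeisAut} (hm : m.IsQuat) (h : m * m * m = 1) :
    m.a = 1 ∧ m.b = 0 ∧ m.c = 0 ∧ m.d = 1 := by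
  have key : ∀ a b c d : ZMod 3, a * d - b * c = 1 → (a + d = 0 ∨ b = 0 ∧ c = 0) →
      (a * a + b * c) * a + (a * b + b * d) * c = 1 →
      (c * a + d * c) * b + (c * b + d * d) * d = 1 →
      a = 1 ∧ b = 0 ∧ c = 0 ∧ d = 1 := by decide +kernel
  exact key _ _ _ _ hm.1 hm.2 (congrArg HeisAut.a h) (congrArg HeisAut.d h)

theorem not_isQuasiAmbivalent_Sigma216 : ¬ IsQuasiAmbivalent Sigma216 := by
  rintro ⟨τ, -, hτ⟩
  have hC : C ∈ Sigma216 := Subgroup.subset_closure (by simp)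
  have hE : E ∈ Sigma216 := Subgroup.subset_closure (by simp)
  have hV : V ∈ Sigma216 := Subgroup.subset_closure (by simp)
  have hX : X ∈ Sigma216 := Subgroup.subset_closure (by simp)
  obtain ⟨z, hz, hzω⟩ := omega_mem hC hE
  let c : Sigma216 := ⟨C, hC⟩
  let e : Sigma216 := ⟨E, hE⟩
  let v : Sigma216 := ⟨V, hV⟩
  let x : Sigma216 := ⟨X, hX⟩
  let w : Sigma216 := ⟨z, hz⟩
  have hw : ((τ w : SU3) : Matrix (Fin 3) (Fin 3) ℂ) = ω ^ 2 • 1 :=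
    coe_apply_eq_of_coe_eq_omega hC hE hτ hzω
  have r1 : v * c = e * v := Subtype.ext V_mul_C
  have r3 : x * c = c * c * e * x := Subtype.ext X_mul_C
  have r5 : e * c = w * (c * e) := by
    apply Subtype.ext
    apply Subtype.ext
    change matE * matC = (z : Matrix (Fin 3) (Fin 3) ℂ) * (matC * matE)
    rw [matE_mul_matC, hzω, smul_mul_assoc, one_mul]
  have r6 : c * c * c = 1 := by
    apply Subtype.ext
    apply Subtype.ext
    change matC * matC * matC = 1
    rw [← matC_cube, pow_succ, sq]
  have r7 : e * e * e = 1 := by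
    apply Subtype.ext
    apply Subtype.ext
    change matE * matE * matE = 1
    rw [← matE_cube, pow_succ, sq]
  have a1 := congrArg (fun g => act216 (τ g)) r1
  have a3 := congrArg (fun g => act216 (τ g)) r3
  have a6 := congrArg (fun g => act216 (τ g)) r6
  have a7 := congrArg (fun g => act216 (τ g)) r7
  simp only [map_mul, act216_mul, map_one, act216_one] at a1 a3 a6 a7
  obtain ⟨c1, c2, c3, c4⟩ := HeisAut.eq_of_cube_eq_one (isQuat_act216 _) a6
  obtain ⟨e1, e2, e3, e4⟩ := HeisAut.eq_of_cube_eq_one (isQuat_act216 _) a7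
  have hunit (P : Prop) [Decidable P] : (if P then (1 : ℤ) else -1) = 1 ∨
      (if P then (1 : ℤ) else -1) = -1 := by split_ifs <;> simp
  have hv : act216 v = ⟨0, 2, 1, 0, 0, 0⟩ := act216_eq rel_V
  have hx : act216 x = ⟨2, 1, 1, 1, 2, 0⟩ := act216_eq rel_X
  have v1 := sign_act216_apply hτ signV (by decide) (fun m => hunit _) signV_mul v
  have v2 := sign_act216_apply hτ signX (by decide) (fun m => hunit _) signX_mul v
  have x1 := sign_act216_apply hτ signV (by decide) (fun m => hunit _) signV_mul x
  have x2 := sign_act216_apply hτ signX (by decide) (fun m => hunit _) signX_mul x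
  rw [hv] at v1 v2
  rw [hx] at x1 x2
  have qv := isQuat_act216 (τ v)
  have qx := isQuat_act216 (τ x)
  have rc := rel_act216 (τ c)
  have re := rel_act216 (τ e)
  generalize act216 (τ c) = mc at *
  generalize act216 (τ e) = me at *
  generalize act216 (τ v) = mv at *
  generalize act216 (τ x) = mx at *
  obtain ⟨ca, cb, cc, cd, cp, cq⟩ := mc
  obtain ⟨ea, eb, ec, ed, ep, eq⟩ := me
  dsimp only at c1 c2 c3 c4 e1 e2 e3 e4
  subst c1 c2 c3 c4 e1 e2 e3 e4
  obtain ⟨s, hs⟩ := re.eq_smul_wt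
  -- The commutator exponent of τ(C) and τ(E). For C and E themselves it is 2, so the map induced by
  -- τ on 𝔽₃² has determinant -1.
  have hdet : cp * (2 * eq) + cq * ep = 1 := by
    have a5 := congrArg (fun g => toMat Sigma216 (τ g)) r5
    simp only [map_mul, toMat_apply] at a5
    have h1 := rc (2 * eq) ep 0
    rw [hw, ← Submonoid.coe_mul, smul_mul_assoc, one_mul] at a5
    have h2 : ((τ c : SU3) : Matrix (Fin 3) (Fin 3) ℂ) * (τ e : SU3) =
        chi (cp * (2 * eq) + cq * ep) • ((τ e : SU3) * (τ c : SU3)) := by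
      rw [hs, mul_smul_comm, h1, smul_mul_assoc, smul_comm, ← smul_mul_assoc (chi _),
        ← one_mul (wt (2 * eq) ep 0), ← smul_mul_assoc (chi _), ← wt_zero, wt_mul]
      congr 3 <;> ring
    rw [Submonoid.coe_mul, h2, smul_smul, ← Submonoid.coe_mul] at a5
    have h3 := eq_one_of_eq_smul a5
    rw [← chi_two, ← chi_add] at h3
    have h4 : (3 : ZMod 3) = 0 := by decide
    linear_combination chi_eq_one h3 - h4
  -- The two signs determine an element of Q₈ up to ±1, so the linear parts of τ(V) and τ(X) are
  -- known up to sign.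
  have key1 : ∀ a b c d p q : ZMod 3, a * d - b * c = 1 → (a + d = 0 ∨ b = 0 ∧ c = 0) →
      signV ⟨a, b, c, d, p, q⟩ = signV ⟨0, 2, 1, 0, 0, 0⟩ →
      signX ⟨a, b, c, d, p, q⟩ = signX ⟨0, 2, 1, 0, 0, 0⟩ →
      a = 0 ∧ d = 0 ∧ (b = 2 ∧ c = 1 ∨ b = 1 ∧ c = 2) := by decide +kernel
  have key2 : ∀ a b c d p q : ZMod 3, a * d - b * c = 1 → (a + d = 0 ∨ b = 0 ∧ c = 0) →
      signV ⟨a, b, c, d, p, q⟩ = signV ⟨2, 1, 1, 1, 2, 0⟩ →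
      signX ⟨a, b, c, d, p, q⟩ = signX ⟨2, 1, 1, 1, 2, 0⟩ →
      (a = 2 ∧ b = 1 ∧ c = 1 ∧ d = 1 ∨ a = 1 ∧ b = 2 ∧ c = 2 ∧ d = 2) := by decide +kernel
  obtain ⟨va, vd, vbc⟩ := key1 _ _ _ _ _ _ qv.1 qv.2 v1 v2
  have xabcd := key2 _ _ _ _ _ _ qx.1 qx.2 x1 x2
  have p1 := congrArg HeisAut.p a1
  have p2 := congrArg HeisAut.q a1
  have p3 := congrArg HeisAut.p a3
  have p4 := congrArg HeisAut.q a3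
  simp only [HeisAut.mul_def, HeisAut.mul] at p1 p2 p3 p4
  rw [va] at p1
  rw [vd] at p2
  -- The images of VC = EV and XC = C²EX, read in the coordinates p and q, are incompatible with
  -- determinant -1.
  have key3 : ∀ cp cq ep eq vb vc xa xb xc xd : ZMod 3, cp * (2 * eq) + cq * ep = 1 →
      (vb = 2 ∧ vc = 1 ∨ vb = 1 ∧ vc = 2) → cp = eq * vc → cq = ep * vb →
      (xa = 2 ∧ xb = 1 ∧ xc = 1 ∧ xd = 1 ∨ xa = 1 ∧ xb = 2 ∧ xc = 2 ∧ xd = 2) →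
      cp = (ep + 2 * cp) * xa + (eq + 2 * cq) * xc →
      cq ≠ (ep + 2 * cp) * xb + (eq + 2 * cq) * xd := by
    rintro cp cq ep eq vb vc xa xb xc xd h (⟨rfl, rfl⟩ | ⟨rfl, rfl⟩) rfl rfl
      (⟨rfl, rfl, rfl, rfl⟩ | ⟨rfl, rfl, rfl, rfl⟩) <;> revert ep eq <;> decide
  exact key3 _ _ _ _ _ _ _ _ _ _ hdet vbc (by linear_combination p1) (by linear_combination p2)
    xabcd (by linear_combination p3) (by linear_combination p4)

/-! ### Σ(1080): the action on six conics -/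

/-- The ratio of diagonal and off-diagonal entries of the conics permuted by `Σ(1080)`; it equals
`(-1 + i√15 / 3) / 2`. -/
noncomputable def δ : ℂ := (-1 + (2 * ω + 1) * (2 * μ₁ + 1) / 3) / 2

noncomputable def conicAux (s t u : ℂ) : Matrix (Fin 3) (Fin 3) ℂ :=
  !![δ, s * ω ^ 2, t * ω; s * ω ^ 2, ω * δ, u; t * ω, u, ω ^ 2 * δ]

/-- Gram matrices of six conics permuted by `Σ(1080)`. -/
noncomputable def conic : Fin 6 → Matrix (Fin 3) (Fin 3) ℂ :=
  ![1, Matrix.diagonal ![1, ω ^ 2, ω], conicAux 1 1 1, conicAux (-1) (-1) 1, conicAux 1 (-1) (-1),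
    conicAux (-1) 1 (-1)]

theorem mu_sq : μ₁ ^ 2 = 1 - μ₁ := by
  linear_combination μ₁ * mu_add - mu_mul

theorem mu₂_eq : μ₂ = -1 - μ₁ := by
  linear_combination mu_add

theorem omega_sq : ω ^ 2 = -1 - ω := by
  linear_combination omega_sum

theorem delta_sq : δ ^ 2 = -δ - 2 / 3 := by
  unfold δ
  have h1 := omega_sq
  have h2 := mu_sq
  grind

theorem delta_ne_zero : δ ≠ 0 := by
  intro h
  have := delta_sq
  rw [h] at this
  norm_num at this

/-- `g` permutes the six conics as `p`. -/
def ConicRel (g : SU3) (p : Equiv.Perm (Fin 6)) : Prop :=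
  ∀ i, ∃ s : ℂ, (g : Matrix (Fin 3) (Fin 3) ℂ) * conic i * (g : Matrix (Fin 3) (Fin 3) ℂ)ᵀ =
    s • conic (p i)

def permB : Equiv.Perm (Fin 6) := ⟨![0, 1, 3, 2, 5, 4], ![0, 1, 3, 2, 5, 4], by decide, by decide⟩
def permE : Equiv.Perm (Fin 6) := ⟨![0, 1, 2, 4, 5, 3], ![0, 1, 2, 5, 3, 4], by decide, by decide⟩
def permW : Equiv.Perm (Fin 6) := ⟨![0, 2, 1, 3, 5, 4], ![0, 2, 1, 3, 5, 4], by decide, by decide⟩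
def permQ : Equiv.Perm (Fin 6) := ⟨![1, 0, 2, 3, 5, 4], ![1, 0, 2, 3, 5, 4], by decide, by decide⟩

theorem conic_zero : conic 0 = !![1, 0, 0; 0, 1, 0; 0, 0, 1] := by
  rw [← Matrix.one_fin_three]; rfl

theorem conic_one : conic 1 = !![1, 0, 0; 0, ω ^ 2, 0; 0, 0, ω] := by
  change Matrix.diagonal ![1, ω ^ 2, ω] = _
  ext i j
  fin_cases i <;> fin_cases j <;> simp

theorem conic_two : conic 2 = conicAux 1 1 1 := rfl
theorem conic_three : conic 3 = conicAux (-1) (-1) 1 := rfl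
theorem conic_four : conic 4 = conicAux 1 (-1) (-1) := rfl
theorem conic_five : conic 5 = conicAux (-1) 1 (-1) := rfl

theorem conicRel_B : ConicRel B permB := by
  intro i
  refine ⟨1, ?_⟩
  rw [one_smul]
  fin_cases i <;> simp [B, permB, conic_zero, conic_one, conic_two, conic_three, conic_four,
    conic_five, conicAux] <;>
  · ext i j
    fin_cases i <;> fin_cases j <;>
      simp [matB, Matrix.mul_apply, Fin.sum_univ_three]

theorem conicRel_E : ConicRel E permE := by
  have h := omega_cube
  have key (i : Fin 6) : matE * conic i * matEᵀ =
      (![1, ω ^ 2, ω, ω, ω, ω] : Fin 6 → ℂ) i • conic (permE i) := by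
    fin_cases i <;> simp [permE, conic_zero, conic_one, conic_two, conic_three, conic_four,
      conic_five, conicAux] <;>
    · ext i j
      fin_cases i <;> fin_cases j <;>
        simp [matE, Matrix.mul_apply, Fin.sum_univ_three] <;> grind
  exact fun i => ⟨_, key i⟩

theorem conicRel_Q : ConicRel Q permQ := by
  have h := omega_cube
  intro i
  refine ⟨1, ?_⟩
  rw [one_smul]
  fin_cases i <;> simp [Q, permQ, conic_zero, conic_one, conic_two, conic_three, conic_four,
    conic_five, conicAux] <;>
  · ext i j
    fin_cases i <;> fin_cases j <;>
      simp [matQ, Matrix.mul_apply, Fin.sum_univ_three] <;> grind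

theorem matW_mul_matW : matW * matW = 1 := by
  have h2 := mu_sq
  have h3 := mu₂_eq
  ext i j
  fin_cases i <;> fin_cases j <;>
    simp [matW, Matrix.mul_apply, Fin.sum_univ_three] <;> grind

theorem transpose_matW : matWᵀ = matW := by
  ext i j
  fin_cases i <;> fin_cases j <;> simp [matW]

theorem matW_eq : matW = (1 / 2 : ℂ) • !![-1, -1 - μ₁, μ₁; -1 - μ₁, μ₁, -1; μ₁, -1, -1 - μ₁] := by
  rw [matW, mu₂_eq]

/-- W is a symmetric involution, so each congruence reduces to an identity with a single factor W on
either side. -/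
theorem matW_conj {A A' : Matrix (Fin 3) (Fin 3) ℂ} {s : ℂ} (h : matW * A = s • A' * matW) :
    matW * A * matWᵀ = s • A' := by
  rw [h, transpose_matW, mul_assoc, matW_mul_matW, mul_one]

theorem matW_mul_conic_one : matW * conic 1 = (3 / 4 * δ) • conic 2 * matW := by
  have h1 := omega_sq
  have h2 := mu_sq
  rw [matW_eq, conic_one, conic_two]
  ext i j
  fin_cases i <;> fin_cases j <;>
    simp only [conicAux, δ, Matrix.mul_apply, Fin.sum_univ_three, Matrix.smul_apply,
      Matrix.of_apply, Matrix.cons_val, smul_eq_mul, Fin.zero_eta, Fin.mk_one,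
      Fin.reduceFinMk] <;> grind

theorem matW_mul_conic_two : matW * conic 2 = (-2 * (1 + δ)) • conic 1 * matW := by
  have h1 := omega_sq
  have h2 := mu_sq
  rw [matW_eq, conic_two, conic_one]
  ext i j
  fin_cases i <;> fin_cases j <;>
    simp only [conicAux, δ, Matrix.mul_apply, Fin.sum_univ_three, Matrix.smul_apply,
      Matrix.of_apply, Matrix.cons_val, smul_eq_mul, Fin.zero_eta, Fin.mk_one,
      Fin.reduceFinMk] <;> grind

theorem matW_mul_conic_three : matW * conic 3 = (1 : ℂ) • conic 3 * matW := by
  have h1 := omega_sq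
  have h2 := mu_sq
  rw [matW_eq, conic_three]
  ext i j
  fin_cases i <;> fin_cases j <;>
    simp only [conicAux, δ, Matrix.mul_apply, Fin.sum_univ_three, Matrix.smul_apply,
      Matrix.of_apply, Matrix.cons_val, smul_eq_mul, Fin.zero_eta, Fin.mk_one,
      Fin.reduceFinMk] <;> grind

theorem matW_mul_conic_four : matW * conic 4 = ω • conic 5 * matW := by
  have h1 := omega_sq
  have h2 := mu_sq
  rw [matW_eq, conic_four, conic_five]
  ext i j
  fin_cases i <;> fin_cases j <;>
    simp only [conicAux, δ, Matrix.mul_apply, Fin.sum_univ_three, Matrix.smul_apply,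
      Matrix.of_apply, Matrix.cons_val, smul_eq_mul, Fin.zero_eta, Fin.mk_one,
      Fin.reduceFinMk] <;> grind

theorem matW_mul_conic_five : matW * conic 5 = (ω ^ 2) • conic 4 * matW := by
  have h1 := omega_sq
  have h2 := mu_sq
  rw [matW_eq, conic_five, conic_four]
  ext i j
  fin_cases i <;> fin_cases j <;>
    simp only [conicAux, δ, Matrix.mul_apply, Fin.sum_univ_three, Matrix.smul_apply,
      Matrix.of_apply, Matrix.cons_val, smul_eq_mul, Fin.zero_eta, Fin.mk_one,
      Fin.reduceFinMk] <;> grind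

theorem conicRel_W : ConicRel W permW := by
  intro i
  fin_cases i
  · refine ⟨1, ?_⟩
    change matW * 1 * matWᵀ = (1 : ℂ) • 1
    rw [transpose_matW, mul_one, matW_mul_matW, one_smul]
  · exact ⟨_, matW_conj matW_mul_conic_one⟩
  · exact ⟨_, matW_conj matW_mul_conic_two⟩
  · exact ⟨_, matW_conj matW_mul_conic_three⟩
  · exact ⟨_, matW_conj matW_mul_conic_four⟩
  · exact ⟨_, matW_conj matW_mul_conic_five⟩

theorem coe_inv_mul_coe (g : SU3) : ((g⁻¹ : SU3) : Matrix (Fin 3) (Fin 3) ℂ) * g = 1 := by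
  rw [← Submonoid.coe_mul, inv_mul_cancel]; rfl

theorem conic_ne_zero (i : Fin 6) : conic i ≠ 0 := by
  intro h
  have h00 := congrFun (congrFun h 0) 0
  have hd := delta_ne_zero
  fin_cases i <;> simp [conic_zero, conic_one, conic_two, conic_three, conic_four,
    conic_five, conicAux, hd] at h00

theorem eq_of_conic_eq_smul {i j : Fin 6} {s : ℂ} (h : conic i = s • conic j) : i = j := by
  have h00 := congrFun (congrFun h 0) 0
  have h11 := congrFun (congrFun h 1) 1
  have h01 := congrFun (congrFun h 0) 1
  have h02 := congrFun (congrFun h 0) 2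
  have hd := delta_ne_zero
  have h3 := omega_cube
  have h1 := omega_ne_one
  fin_cases i <;> fin_cases j <;> first
  | rfl
  | (exfalso
     simp [conic_zero, conic_one, conic_two, conic_three, conic_four,
       conic_five, conicAux] at h00 h11 h01 h02
     grind)

theorem ConicRel.one : ConicRel 1 1 := fun i => ⟨1, by simp⟩

theorem ConicRel.mul {g h : SU3} {p q : Equiv.Perm (Fin 6)} (hg : ConicRel g p)
    (hh : ConicRel h q) : ConicRel (g * h) (p * q) := by
  intro i
  obtain ⟨s, hs⟩ := hh i
  obtain ⟨t, ht⟩ := hg (q i)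
  refine ⟨s * t, ?_⟩
  rw [Submonoid.coe_mul, transpose_mul, Equiv.Perm.mul_apply, ← smul_smul, ← ht, ← smul_mul_assoc,
    ← mul_smul_comm, ← hs]
  simp only [mul_assoc]

theorem ConicRel.inv {g : SU3} {p : Equiv.Perm (Fin 6)} (hg : ConicRel g p) :
    ConicRel g⁻¹ p⁻¹ := by
  intro i
  obtain ⟨s, hs⟩ := hg (p⁻¹ i)
  rw [show p (p⁻¹ i) = i by simp] at hs
  have h1 := coe_inv_mul_coe g
  have h2 : (g : Matrix (Fin 3) (Fin 3) ℂ)ᵀ * ((g⁻¹ : SU3) : Matrix (Fin 3) (Fin 3) ℂ)ᵀ = 1 := by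
    rw [← transpose_mul, h1, transpose_one]
  have h3 : conic (p⁻¹ i) = s • (((g⁻¹ : SU3) : Matrix (Fin 3) (Fin 3) ℂ) * conic i *
      ((g⁻¹ : SU3) : Matrix (Fin 3) (Fin 3) ℂ)ᵀ) := by
    rw [← smul_mul_assoc, ← mul_smul_comm, ← hs, mul_assoc, mul_assoc, h2, mul_one, ← mul_assoc, h1,
      one_mul]
  have hs0 : s ≠ 0 := by
    rintro rfl
    exact conic_ne_zero _ (by rw [h3, zero_smul])
  exact ⟨s⁻¹, by rw [h3, smul_smul, inv_mul_cancel₀ hs0, one_smul]⟩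

theorem ConicRel.unique {g : SU3} {p q : Equiv.Perm (Fin 6)} (hp : ConicRel g p)
    (hq : ConicRel g q) : p = q := by
  ext1 i
  obtain ⟨s, hs⟩ := (hp.inv.mul hq) i
  simp only [inv_mul_cancel] at hs
  have h : conic i = s • conic ((p⁻¹ * q) i) := by rw [← hs]; simp
  have := eq_of_conic_eq_smul h
  rw [Equiv.Perm.mul_apply, Equiv.Perm.eq_inv_iff_eq] at this
  exact this

theorem exists_conicRel {g : SU3} (hg : g ∈ Sigma1080) : ∃ p, ConicRel g p := by
  induction hg using Subgroup.closure_induction with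
  | mem g hg =>
    rcases hg with rfl | rfl | rfl | rfl
    exacts [⟨_, conicRel_B⟩, ⟨_, conicRel_E⟩, ⟨_, conicRel_W⟩, ⟨_, conicRel_Q⟩]
  | one => exact ⟨1, ConicRel.one⟩
  | mul g h _ _ ihg ihh =>
    obtain ⟨p, hp⟩ := ihg
    obtain ⟨q, hq⟩ := ihh
    exact ⟨_, hp.mul hq⟩
  | inv g _ ih =>
    obtain ⟨p, hp⟩ := ih
    exact ⟨_, hp.inv⟩

/-- The permutation action of `Σ(1080)` on the six conics. -/
noncomputable def conicPerm : Sigma1080 →* Equiv.Perm (Fin 6) where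
  toFun g := (exists_conicRel g.2).choose
  map_one' := (exists_conicRel (1 : Sigma1080).2).choose_spec.unique ConicRel.one
  map_mul' g h := (exists_conicRel (g * h).2).choose_spec.unique
    ((exists_conicRel g.2).choose_spec.mul (exists_conicRel h.2).choose_spec)

theorem conicRel_conicPerm (g : Sigma1080) : ConicRel g (conicPerm g) :=
  (exists_conicRel g.2).choose_spec

theorem conicPerm_eq {g : Sigma1080} {p : Equiv.Perm (Fin 6)} (h : ConicRel g p) :
    conicPerm g = p :=
  (conicRel_conicPerm g).unique h

/-- If conjugation by M rescales two of these matrices by a and b, invariance of the nonzero trace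
of their product gives ab = 1. -/
theorem trace_conic_mul : (conic 1 * conic 2).trace ≠ 0 ∧ (conic 1 * conic 3).trace ≠ 0 ∧
    (conic 2 * conic 3).trace ≠ 0 := by
  have h3 := omega_sum
  have hd := delta_ne_zero
  refine ⟨?_, ?_, ?_⟩ <;> intro h <;>
    simp [conic_one, conic_two, conic_three, conicAux, Matrix.trace, Fin.sum_univ_three] at h <;> grind

/-- An element of `SU(3)` fixing the six conics is scalar. -/
theorem ConicRel.eq_smul_one {g : SU3} (h : ConicRel g 1) :
    ∃ s : ℂ, s ^ 3 = 1 ∧ (g : Matrix (Fin 3) (Fin 3) ℂ) = s • 1 := by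
  set M := (g : Matrix (Fin 3) (Fin 3) ℂ) with hM
  have hdet : M.det = 1 := (mem_specialUnitaryGroup_iff.1 g.2).2
  have hi : ((g⁻¹ : SU3) : Matrix (Fin 3) (Fin 3) ℂ) * M = 1 := coe_inv_mul_coe g
  have hi' : M * ((g⁻¹ : SU3) : Matrix (Fin 3) (Fin 3) ℂ) = 1 := coe_mul_coe_inv g
  obtain ⟨s, hs⟩ := h 0
  have h0 : conic 0 = 1 := rfl
  rw [← hM, Equiv.Perm.one_apply, h0, mul_one] at hs
  have hs3 : s ^ 3 = 1 := by
    have := congrArg Matrix.det hs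
    rw [det_mul, det_transpose, hdet, det_smul, det_one] at this
    simpa using this.symm
  have hs0 : s ≠ 0 := by rintro rfl; simp at hs3
  -- Fixing the conic with matrix 1 means M Mᵀ = s, so Mᵀ = s M⁻¹ and congruence becomes conjugation
  -- up to a scalar.
  have key (i : Fin 6) : ∃ t : ℂ, M * conic i * ((g⁻¹ : SU3) : Matrix (Fin 3) (Fin 3) ℂ) =
      t • conic i := by
    obtain ⟨t, ht⟩ := h i
    rw [← hM, Equiv.Perm.one_apply] at ht
    have hT : Mᵀ = s • ((g⁻¹ : SU3) : Matrix (Fin 3) (Fin 3) ℂ) := by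
      calc Mᵀ = ((g⁻¹ : SU3) : Matrix (Fin 3) (Fin 3) ℂ) * (M * Mᵀ) := by
            rw [← mul_assoc, hi, one_mul]
        _ = _ := by rw [hs, mul_smul_comm, mul_one]
    rw [hT, mul_smul_comm] at ht
    refine ⟨s⁻¹ * t, ?_⟩
    rw [← smul_smul, ← ht, smul_smul, inv_mul_cancel₀ hs0, one_smul]
  obtain ⟨t1, ht1⟩ := key 1
  obtain ⟨t2, ht2⟩ := key 2
  obtain ⟨t3, ht3⟩ := key 3
  have hpair {i j : Fin 6} {a b : ℂ}
      (ha : M * conic i * ((g⁻¹ : SU3) : Matrix (Fin 3) (Fin 3) ℂ) = a • conic i)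
      (hb : M * conic j * ((g⁻¹ : SU3) : Matrix (Fin 3) (Fin 3) ℂ) = b • conic j)
      (hij : (conic i * conic j).trace ≠ 0) : a * b = 1 := by
    have h1 : M * (conic i * conic j) * ((g⁻¹ : SU3) : Matrix (Fin 3) (Fin 3) ℂ) =
        (a * b) • (conic i * conic j) := by
      rw [← smul_mul_smul_comm, ← ha, ← hb]
      simp only [mul_assoc]
      rw [← mul_assoc _ M, hi, one_mul]
    have h2 := congrArg Matrix.trace h1
    rw [trace_mul_comm, ← mul_assoc, hi, one_mul, trace_smul, smul_eq_mul] at h2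
    exact mul_right_cancel₀ hij (by rw [one_mul]; exact h2.symm)
  obtain ⟨n12, n13, n23⟩ := trace_conic_mul
  have e12 := hpair ht1 ht2 n12
  have e13 := hpair ht1 ht3 n13
  have e23 := hpair ht2 ht3 n23
  have e1 : t1 ^ 3 = 1 := by
    have := congrArg Matrix.det ht1
    rw [det_mul, det_mul, mul_comm, ← mul_assoc, ← det_mul, hi, det_one, one_mul, det_smul,
      Fintype.card_fin] at this
    have hc : (conic 1).det = 1 := by
      rw [conic_one, det_fin_three]
      simpa [← pow_succ] using omega_cube
    rw [hc, mul_one] at this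
    exact this.symm
  -- The pairwise products are 1, so the three scalars coincide and are ±1; t1³ = 1 excludes -1.
  have t1_one : t1 = 1 := by grind
  have t2_one : t2 = 1 := by grind
  have comm {i : Fin 6} (hc : M * conic i * ((g⁻¹ : SU3) : Matrix (Fin 3) (Fin 3) ℂ) =
      (1 : ℂ) • conic i) : M * conic i = conic i * M := by
    rw [one_smul] at hc
    rw [← hc, mul_assoc _ _ M, hi, mul_one, hc]
  rw [t1_one] at ht1
  rw [t2_one] at ht2
  have c1 := comm ht1
  have c2 := comm ht2
  rw [conic_one] at c1
  rw [conic_two] at c2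
  have o3 := omega_cube
  have o1 := omega_ne_one
  -- Commuting with `conic 1`, diagonal with distinct entries, makes M diagonal; the nonzero
  -- off-diagonal entries of `conic 2` make it scalar.
  have hM' : M = M 0 0 • 1 := by
    have e (i j : Fin 3) := congrFun (congrFun c1 i) j
    have f (i j : Fin 3) := congrFun (congrFun c2 i) j
    have e01 := e 0 1
    have e02 := e 0 2
    have e10 := e 1 0
    have e12' := e 1 2
    have e20 := e 2 0
    have e21 := e 2 1
    have f01 := f 0 1
    have f12 := f 1 2
    simp only [conicAux, Matrix.mul_apply, Fin.sum_univ_three, Matrix.of_apply,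
      Matrix.cons_val] at e01 e02 e10 e12' e20 e21 f01 f12
    ext i j
    fin_cases i <;> fin_cases j <;> simp <;> grind
  refine ⟨M 0 0, ?_, hM'⟩
  rw [hM', det_smul, det_one] at hdet
  simpa using hdet

theorem exists_eq_mul_of_conicPerm_eq {g h : Sigma1080} (hgh : conicPerm g = conicPerm h) :
    ∃ s : ℂ, s ^ 3 = 1 ∧ toMat Sigma1080 g = s • toMat Sigma1080 h := by
  have h1 : ConicRel (g * h⁻¹ : Sigma1080) 1 := by
    have := conicRel_conicPerm (g * h⁻¹)
    rwa [map_mul, map_inv, hgh, mul_inv_cancel] at this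
  obtain ⟨s, hs, hz⟩ := h1.eq_smul_one
  refine ⟨s, hs, ?_⟩
  have h2 : g = (g * h⁻¹) * h := by group
  rw [h2, map_mul, toMat_apply, hz, smul_mul_assoc, one_mul]

/-! ### Σ(1080): fixed points and traces -/

/-- The number of fixed points of a permutation. -/
def fixCount (p : Equiv.Perm (Fin 6)) : ℕ := (Finset.univ.filter fun i => p i = i).card

theorem trace_permMatrixHom (p : Equiv.Perm (Fin 6)) :
    (Matrix.permMatrixHom (R := ℂ) p).trace = fixCount p⁻¹ := by
  change (Equiv.Perm.permMatrix ℂ p⁻¹).trace = _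
  rw [Matrix.trace_permutation]
  congr 1
  rw [fixCount, ← Set.ncard_coe_finset]
  congr 1
  ext i
  simp only [Finset.coe_filter, Finset.mem_univ, true_and, Function.fixedPoints, Function.IsFixedPt]

theorem fixCount_inv (p : Equiv.Perm (Fin 6)) : fixCount p⁻¹ = fixCount p := by
  unfold fixCount
  congr 1
  ext i
  simp only [Finset.mem_filter, Finset.mem_univ, true_and]
  rw [Equiv.Perm.inv_eq_iff_eq, eq_comm]

/-- This is the permutation character, which takes equal values at an element and its inverse. -/
theorem fixCount_conicPerm_apply {τ : MulAut Sigma1080} (hτ : IsClassInverting τ) (g : Sigma1080) :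
    fixCount (conicPerm (τ g)) = fixCount (conicPerm g) := by
  have h := hτ.trace_map_eq ((Matrix.permMatrixHom (R := ℂ)).comp conicPerm) g
  simp only [MonoidHom.comp_apply, trace_permMatrixHom, map_inv, inv_inv, Nat.cast_inj] at h
  rw [fixCount_inv] at h
  exact h

/-- The action of `W * B * E`, of order five, on the conics. -/
def permU : Equiv.Perm (Fin 6) := ⟨![0, 2, 3, 4, 5, 1], ![0, 5, 1, 2, 3, 4], by decide, by decide⟩

/-- The square of `permU`. -/
def permU2 : Equiv.Perm (Fin 6) := ⟨![0, 3, 4, 5, 1, 2], ![0, 4, 5, 1, 2, 3], by decide, by decide⟩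

theorem permW_mul_permB_mul_permE : permW * permB * permE = permU := by decide

theorem permU_mul_permU : permU * permU = permU2 := by decide

/-- Permutations moving the conic `0` to each of the six conics. -/
def transversalZero : List (Equiv.Perm (Fin 6)) :=
  [1, permQ, permW * permQ, permB * permW * permQ, permE * permB * permW * permQ,
    permE * permE * permB * permW * permQ]

theorem exists_transversalZero : ∀ i : Fin 6, ∃ a ∈ transversalZero, a 0 = i := by decide

/-- The tetrahedral group generated by `permB` and `permE`, up to right multiplication by powers
of `permE`. -/
def tetrahedral : List (Equiv.Perm (Fin 6)) :=
  [1, permB, permE * permB * permE * permE, permE * permE * permB * permE]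

/-- The hypotheses say that p is a 5-cycle on the points other than 0 (type 2+3 has a square with
more fixed points). The 24 such cycles form two classes under A₅, those of U and U², and the twelve
tetrahedral elements represent the cosets of ⟨U⟩. -/
theorem eq_conj_permU_of_fixCount : ∀ p : Equiv.Perm (Fin 6), p 0 = 0 ∧ fixCount p = 1 ∧
    fixCount (p * p) = 1 → ∃ b ∈ tetrahedral, ∃ c ∈ [1, permE, permE * permE],
      p * (b * c) = (b * c) * permU ∨ p * (b * c) = (b * c) * permU2 := by
  decide +kernel

/-- The first two counts make q a double transposition; the two words in q and U single out the
orbit of Q under conjugation by ⟨U⟩. -/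
theorem eq_conj_permQ_of_fixCount : ∀ q : Equiv.Perm (Fin 6), fixCount q = 2 ∧
    fixCount (q * q) = 6 ∧ fixCount (q * permU2 * q * (permU2 * permU)) = 0 ∧
    fixCount (q * permU * q * permU2 * q * (permU2 * permU2)) = 3 →
    ∃ t ∈ [1, permU, permU2, permU2 * permU, permU2 * permU2], q * t = t * permQ := by
  decide +kernel

/-! The generators as elements of `Σ(1080)`. -/

noncomputable def genB : Sigma1080 := ⟨B, Subgroup.subset_closure (by simp)⟩
noncomputable def genE : Sigma1080 := ⟨E, Subgroup.subset_closure (by simp)⟩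
noncomputable def genW : Sigma1080 := ⟨W, Subgroup.subset_closure (by simp)⟩
noncomputable def genQ : Sigma1080 := ⟨Q, Subgroup.subset_closure (by simp)⟩
noncomputable def genU : Sigma1080 := genW * genB * genE

theorem conicPerm_genB : conicPerm genB = permB := conicPerm_eq conicRel_B
theorem conicPerm_genE : conicPerm genE = permE := conicPerm_eq conicRel_E
theorem conicPerm_genW : conicPerm genW = permW := conicPerm_eq conicRel_W
theorem conicPerm_genQ : conicPerm genQ = permQ := conicPerm_eq conicRel_Q

theorem conicPerm_genU : conicPerm genU = permU := by
  rw [genU, map_mul, map_mul, conicPerm_genB, conicPerm_genE, conicPerm_genW,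
    permW_mul_permB_mul_permE]

theorem transversalZero_subset : ∀ a ∈ transversalZero, a ∈ conicPerm.range := by
  have hB : permB ∈ conicPerm.range := ⟨_, conicPerm_genB⟩
  have hE : permE ∈ conicPerm.range := ⟨_, conicPerm_genE⟩
  have hW : permW ∈ conicPerm.range := ⟨_, conicPerm_genW⟩
  have hQ : permQ ∈ conicPerm.range := ⟨_, conicPerm_genQ⟩
  have mul {a b} := conicPerm.range.mul_mem (x := a) (y := b)
  simp only [transversalZero, List.forall_mem_cons]
  exact ⟨one_mem _, hQ, mul hW hQ, mul (mul hB hW) hQ, mul (mul (mul hE hB) hW) hQ,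
    mul (mul (mul (mul hE hE) hB) hW) hQ, by simp⟩

theorem tetrahedral_subset : ∀ b ∈ tetrahedral, ∀ c ∈ [1, permE, permE * permE],
    b * c ∈ conicPerm.range := by
  have hB : permB ∈ conicPerm.range := ⟨_, conicPerm_genB⟩
  have hE : permE ∈ conicPerm.range := ⟨_, conicPerm_genE⟩
  have mul {a b} := conicPerm.range.mul_mem (x := a) (y := b)
  have h1 : ∀ b ∈ tetrahedral, b ∈ conicPerm.range := by
    simp only [tetrahedral, List.forall_mem_cons]
    exact ⟨one_mem _, hB, mul (mul (mul hE hB) hE) hE, mul (mul (mul hE hE) hB) hE, by simp⟩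
  have h2 : ∀ c ∈ [1, permE, permE * permE], c ∈ conicPerm.range := by
    simp only [List.forall_mem_cons]
    exact ⟨one_mem _, hE, mul hE hE, by simp⟩
  exact fun b hb c hc => mul (h1 b hb) (h2 c hc)

theorem toMat_genU : toMat Sigma1080 genU =
    (1 / 2 : ℂ) • !![-μ₁, -1, -μ₂; 1, μ₂, -μ₁; -μ₂, μ₁, 1] := by
  change matW * matB * matE = _
  ext i j
  fin_cases i <;> fin_cases j <;>
    simp [matW, matB, matE, Matrix.mul_apply, Fin.sum_univ_three]

theorem trace_genU : (toMat Sigma1080 genU).trace = -μ₁ := by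
  rw [toMat_genU]
  simp [Matrix.trace_fin_three]
  linear_combination (1 / 2) * mu_add

theorem trace_genU_sq : (toMat Sigma1080 (genU * genU)).trace = -μ₂ := by
  rw [map_mul, toMat_genU]
  simp [Matrix.trace_fin_three]
  have h1 := mu_sq
  have h2 := mu₂_eq
  grind

theorem trace_genQ : (toMat Sigma1080 genQ).trace = -1 := by
  change matQ.trace = _
  simp [Matrix.trace_fin_three, matQ]

theorem trace_genU_mul_genQ : (toMat Sigma1080 (genU * genQ)).trace = -(μ₁ * ω) := by
  rw [map_mul, toMat_genU]
  change (_ * matQ).trace = _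
  simp [Matrix.trace_fin_three, matQ]
  linear_combination (1 / 2) * μ₁ * omega_sum

theorem mu₁_ne_zero : μ₁ ≠ 0 := by
  intro h
  have := mu_mul
  simp [h] at this

theorem mu_cube_ne : μ₁ ^ 3 ≠ μ₂ ^ 3 := by
  intro h
  have h1 := mu_sq
  rw [mu₂_eq] at h
  have h2 : 2 * μ₁ = -1 := by grind
  grind

/-- Up to an inner automorphism, a class-inverting automorphism of `Σ(1080)` fixes the action on
the conics of the element `genU` of order five up to squaring. -/
theorem exists_conj_conicPerm_genU {τ : MulAut Sigma1080} (hτ : IsClassInverting τ) :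
    ∃ σ : MulAut Sigma1080, IsClassInverting σ ∧
      (conicPerm (σ genU) = permU ∨ conicPerm (σ genU) = permU2) := by
  have fix1 {σ : MulAut Sigma1080} (hσ : IsClassInverting σ) :
      fixCount (conicPerm (σ genU)) = 1 := by
    rw [fixCount_conicPerm_apply hσ, conicPerm_genU]
    decide
  have fix2 {σ : MulAut Sigma1080} (hσ : IsClassInverting σ) :
      fixCount (conicPerm (σ genU) * conicPerm (σ genU)) = 1 := by
    rw [← map_mul, ← map_mul, fixCount_conicPerm_apply hσ, map_mul, conicPerm_genU]
    decide
  have conj (σ : MulAut Sigma1080) (h : Sigma1080) : conicPerm ((MulAut.conj h⁻¹ * σ) genU) =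
      (conicPerm h)⁻¹ * conicPerm (σ genU) * conicPerm h := by
    simp [MulAut.mul_apply]
  -- The unique fixed conic of τ(U) is first moved to 0 by an inner automorphism.
  obtain ⟨i, hi⟩ : ∃ i, conicPerm (τ genU) i = i := by
    have := fix1 hτ
    obtain ⟨i, hi⟩ := Finset.card_pos.1 (lt_of_lt_of_eq one_pos this.symm)
    exact ⟨i, (Finset.mem_filter.1 hi).2⟩
  obtain ⟨a, ha, rfl⟩ := exists_transversalZero i
  obtain ⟨h, rfl⟩ := transversalZero_subset a ha
  have hσ := hτ.conj_mul h⁻¹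
  have h0 : conicPerm ((MulAut.conj h⁻¹ * τ) genU) 0 = 0 := by
    rw [conj, Equiv.Perm.mul_apply, Equiv.Perm.mul_apply, hi]
    simp
  obtain ⟨b, hb, c, hc, hbc⟩ := eq_conj_permU_of_fixCount _ ⟨h0, fix1 hσ, fix2 hσ⟩
  obtain ⟨k, hk⟩ := tetrahedral_subset b hb c hc
  refine ⟨_, hσ.conj_mul k⁻¹, ?_⟩
  rw [conj, hk, mul_assoc]
  rcases hbc with h | h
  · left; rw [h, inv_mul_cancel_left]
  · right; rw [h, inv_mul_cancel_left]

theorem not_isQuasiAmbivalent_Sigma1080 : ¬ IsQuasiAmbivalent Sigma1080 := by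
  rintro ⟨τ', -, hτ'⟩
  obtain ⟨τ, hτ, hu⟩ := exists_conj_conicPerm_genU hτ'
  have tru := trace_apply_classInverting hτ genU
  have star1 : star (-μ₁) = -μ₁ := by
    rw [star_neg]; exact congrArg Neg.neg star_mu₁
  rw [trace_genU, star1] at tru
  rcases hu with hu | hu
  swap
  · rw [← permU_mul_permU, ← conicPerm_genU, ← map_mul] at hu
    obtain ⟨s, hs, h⟩ := exists_eq_mul_of_conicPerm_eq hu
    rw [h, trace_smul, trace_genU_sq, smul_eq_mul] at tru
    -- Here μ₁ = s μ₂ with s³ = 1; the combination cubes this relation.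
    exact mu_cube_ne (by
      linear_combination tru * (μ₁ ^ 2 + μ₁ * (s * μ₂) + (s * μ₂) ^ 2) + μ₂ ^ 3 * hs)
  · rw [← conicPerm_genU] at hu
    obtain ⟨s, hs, h⟩ := exists_eq_mul_of_conicPerm_eq hu
    have hs1 : s = 1 := by
      rw [h, trace_smul, trace_genU, smul_eq_mul] at tru
      exact mul_right_cancel₀ (neg_ne_zero.2 mu₁_ne_zero) (by rw [tru, one_mul])
    rw [hs1, one_smul] at h
    rw [conicPerm_genU] at hu
    have word (g : Sigma1080) := fixCount_conicPerm_apply hτ g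
    have w1 := word genQ
    have w2 := word (genQ * genQ)
    have w3 := word (genQ * (genU * genU) * genQ * (genU * genU * genU))
    have w4 := word (genQ * genU * genQ * (genU * genU) * genQ * (genU * genU * (genU * genU)))
    simp only [map_mul, hu, conicPerm_genU, conicPerm_genQ, permU_mul_permU] at w1 w2 w3 w4
    obtain ⟨t, ht, hq⟩ := eq_conj_permQ_of_fixCount (conicPerm (τ genQ))
      ⟨w1.trans (by decide), w2.trans (by decide), w3.trans (by decide), w4.trans (by decide)⟩
    -- Since t is a power of U, conjugation by the corresponding power fixes U and sends Q to τ(Q)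
    -- at once, hence UQ to τ(UQ).
    obtain ⟨n, hn⟩ : ∃ n : ℕ, t = permU ^ n := by
      simp only [← permU_mul_permU, List.mem_cons, List.not_mem_nil, or_false] at ht
      rcases ht with rfl | rfl | rfl | rfl | rfl
      exacts [⟨0, rfl⟩, ⟨1, (pow_one _).symm⟩, ⟨2, (sq _).symm⟩, ⟨3, by rw [pow_succ, sq]⟩,
        ⟨4, by rw [pow_succ, pow_succ, sq]; rfl⟩]
    have hk : conicPerm (τ genQ) = conicPerm (genU ^ n * genQ * (genU ^ n)⁻¹) := by
      rw [map_mul, map_mul, map_inv, map_pow, conicPerm_genU, conicPerm_genQ, ← hn, ← hq,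
        mul_inv_cancel_right]
    obtain ⟨r, hr, h'⟩ := exists_eq_mul_of_conicPerm_eq hk
    have trconj (g k : Sigma1080) : (toMat Sigma1080 (k * g * k⁻¹)).trace =
        (toMat Sigma1080 g).trace := by
      rw [map_mul, trace_mul_comm, ← map_mul, ← mul_assoc, inv_mul_cancel, one_mul]
    have trq := trace_apply_classInverting hτ genQ
    rw [h', trace_smul, trconj, trace_genQ, smul_eq_mul, star_neg, star_one] at trq
    have hr1 : r = 1 := by linear_combination -trq
    rw [hr1, one_smul] at h'
    -- The trace -μ₁ω of UQ would equal its own conjugate -μ₁ω².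
    have truq := trace_apply_classInverting hτ (genU * genQ)
    rw [map_mul, map_mul, h, h', ← map_mul,
      show genU * (genU ^ n * genQ * (genU ^ n)⁻¹) = genU ^ n * (genU * genQ) * (genU ^ n)⁻¹ by
        rw [← mul_assoc, ← mul_assoc, ← pow_succ', pow_succ, mul_assoc _ genU], trconj,
      trace_genU_mul_genQ, star_neg, star_mul'] at truq
    have e1 : star μ₁ = μ₁ := star_mu₁
    have e2 : star ω = ω ^ 2 := star_omega
    rw [e1, e2, neg_inj] at truq
    have h3 := mul_left_cancel₀ mu₁_ne_zero truq
    apply omega_ne_one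
    have h0 : ω ≠ 0 := by
      intro h; have := omega_cube; simp [h] at this
    exact mul_left_cancel₀ h0 (by linear_combination -h3)

end CrystalLike

theorem mainTheorem6 :
    (IsQuasiAmbivalent CrystalLike.Sigma108 ∧ ¬ IsAmbivalent CrystalLike.Sigma108) ∧
    (IsQuasiAmbivalent CrystalLike.Sigma648 ∧ ¬ IsAmbivalent CrystalLike.Sigma648) ∧
    ¬ IsQuasiAmbivalent CrystalLike.Sigma216 ∧
    ¬ IsQuasiAmbivalent CrystalLike.Sigma1080 :=
  ⟨⟨CrystalLike.isQuasiAmbivalent_Sigma108, CrystalLike.not_isAmbivalent_Sigma108⟩,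
    ⟨CrystalLike.isQuasiAmbivalent_Sigma648, CrystalLike.not_isAmbivalent_Sigma648⟩,
    CrystalLike.not_isQuasiAmbivalent_Sigma216, CrystalLike.not_isQuasiAmbivalent_Sigma1080⟩
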